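/- **Setting.** There are $n$ tasks $T_i=(c_i,d_i,b_i)$ with required cycles $c_i\ge 0$, relative deadline $d_i>0$ and arrival time $b_i\ge 0$, and $m_r\ge 1$ processors of type $r\in\{1,2\}$. Let $f_{\max}>0$ be the maximum system frequency, $\underline x_i:=c_i/f_{\max}$, $L:=\max_i(b_i+d_i)$ and $\Gamma:=[0,L]$. Let $0=\tau_0<\dots<\tau_N=L$ consist of $0$ and the distinct arrival times $b_i$ and deadlines $b_i+d_i$, and let $h[\mu]:=\tau_{\mu+1}-\tau_\mu$. For each type let $s^r_1,\dots,s^r_{l_r}\in[0,1]$ be finitely many ($l_r\ge1$) distinct speed levels, with least value $s^r_{\min}$ and greatest value $s^r_{\max}$. *Scheduling problem with speed sets $S^r$* (1): find $x_i(\cdot),a^r_{ik}(\cdot),s^r_k(\cdot)$ such that $x_i(b_i)=\underline x_i$; $x_i(t)=0$ for $t\in\Gamma\setminus[b_i,b_i+d_i)$; $x_i$ is absolutely continuous on $[b_i,b_i+d_i]$; $\dot x_i(t)\ge-\sum_r\sum_k a^r_{ik}(t)s^r_k(t)$ for a.e. $t\in\Gamma$; and, on $\Gamma$, $\sum_r\sum_k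 a^r_{ik}\le1$, $\sum_i a^r_{ik}\le1$, $s^r_k\in S^r$, $a^r_{ik}\in\{0,1\}$, where $a^r_{ik}$ and $s^r_k$ are step functions (constant on each part of a finite partition of $\Gamma$). *NLP* (4): find $x_i[\mu]$ ($0\le\mu\le N$) and $\omega^r_i[\mu],s^r_i[\mu]$ ($0\le\mu<N$) with $x_i[\mu]=\underline x_i$ if $\tau_\mu=b_i$; $x_i[\mu]=0$ if $\tau_\mu\notin[b_i,b_i+d_i)$; $x_i[\mu+1]\ge x_i[\mu]-h[\mu]\sum_r\omega^r_i[\mu]s^r_i[\mu]$; $\sum_r\omega^r_i[\mu]\le1$; $\sum_i\omega^r_i[\mu]\le m_r$; $s^r_{\min}\le s^r_i[\mu]\le s^r_{\max}$; $0\le\omega^r_i[\mu]\le1$. *LP* (5): the same for $x_i[\mu]$ and $\omega^r_{iq}[\mu]\in[0,1]$, $1\le q\le l_r$, with $\sum_q\omega^r_{iq}[\mu]$ in place of $\omega^r_i[\mu]$ and $\sum_q\omega^r_{iq}[\mu]s^r_q$ in place of $\omega^r_i[\mu]s^r_i[\mu]$; there are no speed variables. For an LP solution put $\omega^r_i:=\sum_q\omega^r_{iq}$.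 *Hetero-Wrap* (in each interval $[\tau_\mu,\tau_{\mu+1})$): let $IM_a$, resp. $IM_b$, be the set of tasks with $\omega^1_i,\omega^2_i>0$ and $\omega^1_i+\omega^2_i=1$, resp. $<1$, and let $CP_r$ be the set of tasks with positive fraction on type $r$ only. On type 1, tasks in the order $IM_a,IM_b,CP_1$ are placed consecutively, with lengths $\omega^1_i$, on the line $[0,m_1]$ from left to right starting at $0$; on type 2, tasks in the order $IM_a,IM_b,CP_2$ are placed, with lengths $\omega^2_i$, on $[0,m_2]$ from right to left starting at $m_2$ (each class ordered by task number). Processor $k$ owns $[k-1,k]$; a task that crosses an integer is split between two processors. The output $[\sigma^r_{ik},\eta^r_{ik})\subseteq[0,1]$ is the part of task $i$ on processor $k$, shifted by $k-1$ (empty if there is none). The associated assignment is $a^r_{ik}(t)=1$ if $\sigma^r_{ik}[\mu]h[\mu]\le t-\tau_\mu<\eta^r_{ik}[\mu]h[\mu]$ with $t\in[\tau_\mu,\tau_{\mu+1})$ for some $\mu$, and $a^r_{ik}(t)=0$ otherwise. A task in $IM_b$ is called an inter-cluster migrating task. **Theorem 8.** (i) If, for speed sets $S^r$ each equal to $\{s^r_1,\dots,s^r_{l_r}\}$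 or to $[s^r_{\min},s^r_{\max}]$, the scheduling problem (1) has a solution, then the NLP (4) and the LP (5) have solutions. (ii) If the LP has a solution, then it has a solution that is a vertex (extreme point) of its feasible region and has at most one inter-cluster migrating task in each interval. If the NLP has a solution, then it has one with at most one inter-cluster migrating task in each interval. (iii) For every LP solution with at most one inter-cluster migrating task in each interval, the Hetero-Wrap assignment $a$, together with suitable states $x_i$ and speeds $s^r_k$, the latter constant on the parts of a finite partition of $\Gamma$ into intervals, solves the scheduling problem with $S^r=\{s^r_1,\dots,s^r_{l_r}\}$; moreover $\int_{\tau_\mu}^{\tau_{\mu+1}}\sum_k a^r_{ik}(t)\,dt=h[\mu]\omega^r_i[\mu]$, and task $i$ runs on type $r$ at speed level $q$ for total time $h[\mu]\omega^r_{iq}[\mu]$ in $[\tau_\mu,\tau_{\mu+1})$. For every NLP solution with at most one inter-cluster migrating task in each interval, the Hetero-Wrap assignment $a$, together with suitable states $x_i$ and speeds $s^r_k$, the latter constant on the parts of a finite partition of $\Gamma$ into intervals, solves the scheduling problem with $S^r=[s^r_{\min},s^r_{\max}]$; moreover $\int_{\tau_\mu}^{\tau_{\mu+1}}\sum_k a^r_{ik}(t)\,dt=h[\mu]\omega^r_i[\mu]$,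 and $s^r_k(t)=s^r_i[\mu]$ whenever $a^r_{ik}(t)=1$ and $t\in[\tau_\mu,\tau_{\mu+1})$. -/

import Mathlib

open Set MeasureTheory

noncomputable section

namespace HeteroSched

/-- `n` aperiodic real-time tasks `(c i, d i, b i)` (required cycles, relative deadline, arrival
time) on a two-type platform: `fmax` is the maximum system frequency and `m r` is the number of
processors of type `r`. The types 1 and 2 are represented by `0 1 : Fin 2`. -/
structure Instance (n : ℕ) where
  c : Fin n → ℝ
  d : Fin n → ℝ
  b : Fin n → ℝ
  fmax : ℝ
  m : Fin 2 → ℕ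
  c_nonneg : ∀ i, 0 ≤ c i
  d_pos : ∀ i, 0 < d i
  b_nonneg : ∀ i, 0 ≤ b i
  fmax_pos : 0 < fmax
  m_pos : ∀ r, 0 < m r

namespace Instance

variable {n : ℕ} (P : Instance n)

/-- Minimum execution time of a task (its execution time at the maximum system frequency). -/
def minExec (i : Fin n) : ℝ := P.c i / P.fmax

/-- Absolute deadline of a task. -/
def deadline (i : Fin n) : ℝ := P.b i + P.d i

/-- The largest deadline of all tasks. -/
def horizon : ℝ := ⨆ i, P.deadline i

/-- The time window `[b i, b i + d i)` of a task. -/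
def window (i : Fin n) : Set ℝ := Ico (P.b i) (P.deadline i)

/-- `τ 0 < τ 1 < ⋯ < τ N` is the major grid: its points are the time `0` and the distinct arrival
times and deadlines of all tasks. -/
structure IsMajorGrid {N : ℕ} (τ : Fin (N + 1) → ℝ) : Prop where
  strictMono : StrictMono τ
  range_eq : range τ = {0} ∪ range P.b ∪ range P.deadline

end Instance

/-- `X` has a finite partition such that `f` is constant on each part. -/
def IsStepOn (f : ℝ → ℝ) (X : Set ℝ) : Prop :=
  ∃ (p : ℕ) (part : Fin p → Set ℝ) (φ : Fin p → ℝ),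
    Pairwise (fun j j' => Disjoint (part j) (part j')) ∧ ⋃ j, part j = X ∧
      ∀ j, ∀ t ∈ part j, f t = φ j

/-- `X` has a finite partition into intervals such that `f` is constant on each of them. -/
def IsIntervalStepOn (f : ℝ → ℝ) (X : Set ℝ) : Prop :=
  ∃ (p : ℕ) (part : Fin p → Set ℝ) (φ : Fin p → ℝ), (∀ j, (part j).OrdConnected) ∧
    Pairwise (fun j j' => Disjoint (part j) (part j')) ∧ ⋃ j, part j = X ∧
      ∀ j, ∀ t ∈ part j, f t = φ j

/-- `(x, a, s)` solves the continuous-time scheduling problem with the speed sets `S r`. The state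
`x i` is required to be absolutely continuous on the closed window of task `i`, so that the
differential inequality, which holds for almost every time, determines its evolution. -/
structure IsSchedule {n : ℕ} (P : Instance n) (S : Fin 2 → Set ℝ) (x : Fin n → ℝ → ℝ)
    (a : Fin n → (r : Fin 2) → Fin (P.m r) → ℝ → ℝ)
    (s : (r : Fin 2) → Fin (P.m r) → ℝ → ℝ) : Prop where
  initial : ∀ i, x i (P.b i) = P.minExec i
  zero_outside : ∀ i, ∀ t ∈ Icc 0 P.horizon, t ∉ P.window i → x i t = 0
  absCont : ∀ i, AbsolutelyContinuousOnInterval (x i) (P.b i) (P.deadline i)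
  dynamics : ∀ i, ∀ᵐ t, t ∈ Icc 0 P.horizon →
    DifferentiableAt ℝ (x i) t ∧ -(∑ r, ∑ k, a i r k t * s r k t) ≤ deriv (x i) t
  task_le_one : ∀ i, ∀ t ∈ Icc 0 P.horizon, ∑ r, ∑ k, a i r k t ≤ 1
  proc_le_one : ∀ r k, ∀ t ∈ Icc 0 P.horizon, ∑ i, a i r k t ≤ 1
  speed_mem : ∀ r k, ∀ t ∈ Icc 0 P.horizon, s r k t ∈ S r
  binary : ∀ i r k, ∀ t ∈ Icc 0 P.horizon, a i r k t = 0 ∨ a i r k t = 1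
  step_assign : ∀ i r k, IsStepOn (a i r k) (Icc 0 P.horizon)
  step_speed : ∀ r k, IsStepOn (s r k) (Icc 0 P.horizon)

/-- Length `h[μ]` of the `μ`-th interval of the grid. -/
def gridStep {N : ℕ} (τ : Fin (N + 1) → ℝ) (μ : Fin N) : ℝ := τ μ.succ - τ μ.castSucc

/-- `(x, ω, v)` solves the nonlinear workload-partitioning program, where `ω i r μ` is the fraction
of the `μ`-th interval in which task `i` runs on type `r`, at speed `v i r μ`. -/
structure IsNLPSolution {n N : ℕ} (P : Instance n) (smin smax : Fin 2 → ℝ) (τ : Fin (N + 1) → ℝ)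
    (x : Fin n → Fin (N + 1) → ℝ) (ω v : Fin n → Fin 2 → Fin N → ℝ) : Prop where
  initial : ∀ i μ, τ μ = P.b i → x i μ = P.minExec i
  zero_outside : ∀ i μ, τ μ ∉ P.window i → x i μ = 0
  dynamics : ∀ i μ, x i μ.castSucc - gridStep τ μ * ∑ r, ω i r μ * v i r μ ≤ x i μ.succ
  task_le_one : ∀ i μ, ∑ r, ω i r μ ≤ 1
  capacity : ∀ r μ, ∑ i, ω i r μ ≤ (P.m r : ℝ)
  speed_bounds : ∀ i r μ, smin r ≤ v i r μ ∧ v i r μ ≤ smax r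
  frac_bounds : ∀ i r μ, 0 ≤ ω i r μ ∧ ω i r μ ≤ 1

/-- `(x, ω)` solves the workload-partitioning linear program, where `ω i r q μ` is the fraction of
the `μ`-th interval in which task `i` runs on type `r` at the speed level `lev r q`. -/
structure IsLPSolution {n N : ℕ} (P : Instance n) {l : Fin 2 → ℕ}
    (lev : (r : Fin 2) → Fin (l r) → ℝ) (τ : Fin (N + 1) → ℝ)
    (x : Fin n → Fin (N + 1) → ℝ) (ω : Fin n → (r : Fin 2) → Fin (l r) → Fin N → ℝ) : Prop where
  initial : ∀ i μ, τ μ = P.b i → x i μ = P.minExec i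
  zero_outside : ∀ i μ, τ μ ∉ P.window i → x i μ = 0
  dynamics : ∀ i μ,
    x i μ.castSucc - gridStep τ μ * ∑ r, ∑ q, ω i r q μ * lev r q ≤ x i μ.succ
  task_le_one : ∀ i μ, ∑ r, ∑ q, ω i r q μ ≤ 1
  capacity : ∀ r μ, ∑ i, ∑ q, ω i r q μ ≤ (P.m r : ℝ)
  frac_bounds : ∀ i r q μ, 0 ≤ ω i r q μ ∧ ω i r q μ ≤ 1

/-- The feasible region of the linear program. -/
def lpRegion {n N : ℕ} (P : Instance n) {l : Fin 2 → ℕ} (lev : (r : Fin 2) → Fin (l r) → ℝ)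
    (τ : Fin (N + 1) → ℝ) :
    Set ((Fin n → Fin (N + 1) → ℝ) × (Fin n → (r : Fin 2) → Fin (l r) → Fin N → ℝ)) :=
  {z | IsLPSolution P lev τ z.1 z.2}

/-- Total fraction of each interval in which a task runs on each type, over all speed levels. -/
def totalWork {n N : ℕ} {l : Fin 2 → ℕ} (ω : Fin n → (r : Fin 2) → Fin (l r) → Fin N → ℝ) :
    Fin n → Fin 2 → Fin N → ℝ :=
  fun i r μ => ∑ q, ω i r q μ

section HeteroWrap

/-! The Hetero-Wrap algorithm, applied in one interval of the grid to the fractions `w i r`. -/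

variable {n : ℕ}

/-- The task runs on both types, with total fraction one. -/
def IsIMa (w : Fin n → Fin 2 → ℝ) (i : Fin n) : Prop :=
  0 < w i 0 ∧ 0 < w i 1 ∧ w i 0 + w i 1 = 1

/-- The task runs on both types, with total fraction less than one. -/
def IsIMb (w : Fin n → Fin 2 → ℝ) (i : Fin n) : Prop :=
  0 < w i 0 ∧ 0 < w i 1 ∧ w i 0 + w i 1 < 1

/-- The task runs on type `r` only. -/
def IsCP (w : Fin n → Fin 2 → ℝ) (r : Fin 2) (i : Fin n) : Prop :=
  0 < w i r ∧ ∀ r', r' ≠ r → w i r' = 0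

/-- At most one inter-cluster migrating task in each interval of the grid. -/
def AtMostOneInterCluster {N : ℕ} (ω : Fin n → Fin 2 → Fin N → ℝ) : Prop :=
  ∀ μ, {i | IsIMb (fun i r => ω i r μ) i}.Subsingleton

open Classical in
/-- The tasks of type `r` in the order in which the algorithm treats them: first `IMa`, then `IMb`,
then the tasks that run on type `r` only, each class in the order of the task numbers. -/
def taskOrder (w : Fin n → Fin 2 → ℝ) (r : Fin 2) : List (Fin n) :=
  (List.finRange n).filter (fun i => decide (IsIMa w i)) ++
    ((List.finRange n).filter (fun i => decide (IsIMb w i)) ++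
      (List.finRange n).filter (fun i => decide (IsCP w r i)))

/-- State of the algorithm on one type: the current position `p` on the number line, the current
processor `k` (processors are numbered from 1, and processor `k` owns the stretch `[k - 1, k]`), and
the endpoints `σ i k`, `η i k` assigned so far. -/
structure WrapState (n : ℕ) where
  p : ℝ
  k : ℕ
  σ : Fin n → ℕ → ℝ
  η : Fin n → ℕ → ℝ

/-- Assign the interval `[u, v)` on processor `k` to task `i`. -/
def assign (A : WrapState n) (i : Fin n) (k : ℕ) (u v : ℝ) : WrapState n where
  p := A.p
  k := A.k
  σ := Function.update A.σ i (Function.update (A.σ i) k u)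
  η := Function.update A.η i (Function.update (A.η i) k v)

/-- Left-to-right placement of a task with fraction `y` (type 1). -/
def stepLeft (A : WrapState n) (i : Fin n) (y : ℝ) : WrapState n :=
  if A.p = 0 then
    { assign A i A.k 0 y with p := y }
  else if A.p + y ≤ A.k then
    { assign A i A.k (A.p - (A.k - 1)) (A.p + y - (A.k - 1)) with p := A.p + y }
  else
    { assign (assign A i A.k (A.p - (A.k - 1)) 1) i (A.k + 1) 0 (A.p + y - A.k) with
      p := A.p + y
      k := A.k + 1 }

/-- Right-to-left placement of a task with fraction `y` on `M` processors (type 2). -/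
def stepRight (M : ℕ) (A : WrapState n) (i : Fin n) (y : ℝ) : WrapState n :=
  if A.p = M then
    { assign A i A.k (1 - y) 1 with p := M - y }
  else if (A.k : ℝ) - 1 ≤ A.p - y then
    { assign A i A.k (A.p - y - (A.k - 1)) (A.p - (A.k - 1)) with p := A.p - y }
  else
    { assign (assign A i A.k 0 (A.p - (A.k - 1))) i (A.k - 1) (A.p - y - (A.k - 2)) 1 with
      p := A.p - y
      k := A.k - 1 }

/-- Final state of the Hetero-Wrap algorithm on type `r`. Pairs of a task and a processor that are
never assigned keep the empty interval `[0, 0)`. -/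
def heteroWrap (w : Fin n → Fin 2 → ℝ) (m : Fin 2 → ℕ) (r : Fin 2) : WrapState n :=
  if r = 0 then
    (taskOrder w 0).foldl (fun A i => stepLeft A i (w i 0)) ⟨0, 1, fun _ _ => 0, fun _ _ => 0⟩
  else
    (taskOrder w 1).foldl (fun A i => stepRight (m 1) A i (w i 1))
      ⟨m 1, m 1, fun _ _ => 0, fun _ _ => 0⟩

open Classical in
/-- The assignment built from the output of the algorithm in all intervals of the grid: in the
`μ`-th interval, task `i` is active on processor `k` of type `r` at time `t` if and only if
`σ * h[μ] ≤ t - τ μ < η * h[μ]`. -/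
def wrapAssignment {N : ℕ} (m : Fin 2 → ℕ) (τ : Fin (N + 1) → ℝ) (ω : Fin n → Fin 2 → Fin N → ℝ)
    (i : Fin n) (r : Fin 2) (k : Fin (m r)) (t : ℝ) : ℝ :=
  if ∃ μ : Fin N, t ∈ Ico (τ μ.castSucc) (τ μ.succ) ∧
      (heteroWrap (fun i r => ω i r μ) m r).σ i (k + 1) * gridStep τ μ ≤ t - τ μ.castSucc ∧
      t - τ μ.castSucc < (heteroWrap (fun i r => ω i r μ) m r).η i (k + 1) * gridStep τ μ
  then 1 else 0

end HeteroWrap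

end HeteroSched

end

open HeteroSched

/-!
Write each interval of the grid as a unit of time and the processors of type `r` as a line
`[0, m r]`, on which processor `k` (counted from `0`) owns `[k, k + 1]`.

**Schedule to programs.** In an interval of the grid, the rates of change of the states that are
possible with admissible fractions form a closed convex set (a compact convex set plus the
nonnegative orthant). Along a schedule, the vector of derivatives lies in this set at almost every
time, because the binary assignment is itself a vector of admissible fractions and every speed is a
convex combination of levels. Hence its average, which is the increment of the states divided by the
length of the interval, lies in the set as well (`IsSchedule.exists_fractions_interval`); no
measurability of the assignment is needed. Averaging speeds and mixing the extreme levels translate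
between the two programs.

**One inter-cluster migrating task.** The feasible region of the linear program is compact, so some
vertex maximizes the total speed-weighted fraction. If two tasks had slack and ran on both types,
fractions could be moved between them on both types, in a direction that keeps the work on the first
and does not reduce the work on the second. Maximality forces equality, so that the opposite move is
feasible too, and the point is not extreme (`atMostOneInterCluster_of_maximizer`).

**Programs to schedule.** An invariant of the two folds shows that Hetero-Wrap gives task `i` the
interval `[start i r, start i r + w i r)` of the line of type `r`, cut at the integers
(`foldl_stepLeft`, `foldl_stepRight`). Tasks that run on both types come first on both lines, and
all of them but the last have total fraction one; so modulo one a migrating task starts on type 1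
where it ends on type 2, and never runs on two processors at a time
(`exists_isTaskLayout_heteroWrap`). Cutting the interval of a task into consecutive pieces, one for
each speed level, gives the speeds (`exists_isPieceSchedule_wrapAssignment`). The work done in the
window of a task is at least its minimum execution time, by telescoping the discrete dynamics, and
the state is obtained by scaling the work down to exactly that amount (`exists_state`).
-/

namespace HeteroSched

/-! ### Positions in a list of consecutively placed items -/

/-- Total length of the items placed before `i` when the items of `L`, of lengths `y`, are placed
consecutively on a line. -/
noncomputable def placed {n : ℕ} (y : Fin n → ℝ) (L : List (Fin n)) (i : Fin n) : ℝ :=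
  ((L.takeWhile (fun j => decide (j ≠ i))).map y).sum

theorem placed_of_split {n : ℕ} (y : Fin n → ℝ) {s t : List (Fin n)} {i : Fin n} (hi : i ∉ s) :
    placed y (s ++ i :: t) i = (s.map y).sum := by
  unfold placed
  rw [List.takeWhile_append_of_pos]
  · simp
  · intro a ha
    simp only [decide_eq_true_eq]
    rintro rfl
    exact hi ha

theorem placed_append_of_mem {n : ℕ} (y : Fin n → ℝ) {s t : List (Fin n)} {i : Fin n}
    (hi : i ∈ s) : placed y (s ++ t) i = placed y s i := by
  classical
  induction s with
  | nil => simp at hi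
  | cons a s ih =>
    by_cases ha : a = i
    · simp [placed, ha]
    · have hi' : i ∈ s := by simpa [Ne.symm ha] using hi
      have := ih hi'
      simp only [placed, ne_eq, decide_not] at this ⊢
      simp [ha, this]

theorem placed_nonneg {n : ℕ} {y : Fin n → ℝ} (L : List (Fin n)) (hy : ∀ i ∈ L, 0 ≤ y i)
    (i : Fin n) : 0 ≤ placed y L i := by
  unfold placed
  apply List.sum_nonneg
  intro a ha
  obtain ⟨j, hj, rfl⟩ := List.mem_map.1 ha
  exact hy j ((List.takeWhile_sublist _).subset hj)

theorem placed_add_le_sum {n : ℕ} {y : Fin n → ℝ} {L : List (Fin n)} (hy : ∀ i ∈ L, 0 ≤ y i)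
    (hL : L.Nodup) {i : Fin n} (hi : i ∈ L) : placed y L i + y i ≤ (L.map y).sum := by
  obtain ⟨s, t, rfl⟩ := List.append_of_mem hi
  have his : i ∉ s := fun h => (List.nodup_append.1 hL).2.2 i h i (by simp) rfl
  rw [placed_of_split y his]
  have : 0 ≤ (t.map y).sum := by
    apply List.sum_nonneg
    intro a ha
    obtain ⟨j, hj, rfl⟩ := List.mem_map.1 ha
    exact hy j (by simp [hj])
  simp only [List.map_append, List.map_cons, List.sum_append, List.sum_cons]
  linarith

/-- Two items do not overlap: one of them ends before the other starts. -/
theorem placed_disjoint {n : ℕ} {y : Fin n → ℝ} {L : List (Fin n)} (hy : ∀ i ∈ L, 0 ≤ y i)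
    (hL : L.Nodup) {i j : Fin n} (hi : i ∈ L) (hj : j ∈ L) (hij : i ≠ j) :
    placed y L i + y i ≤ placed y L j ∨ placed y L j + y j ≤ placed y L i := by
  induction L using List.reverseRecOn with
  | nil => simp at hi
  | append_singleton L a ih =>
    have hLn : L.Nodup := (List.nodup_append.1 hL).1
    have haL : a ∉ L := fun h => (List.nodup_append.1 hL).2.2 a h a (by simp) rfl
    have hyL : ∀ i ∈ L, 0 ≤ y i := fun i hi => hy i (by simp [hi])
    have hpa : placed y (L ++ [a]) a = (L.map y).sum := placed_of_split y haL
    simp only [List.mem_append, List.mem_singleton] at hi hj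
    rcases hi with hi | rfl <;> rcases hj with hj | rfl
    · rw [placed_append_of_mem y hi, placed_append_of_mem y hj]
      exact ih hyL hLn hi hj
    · rw [hpa, placed_append_of_mem y hi]
      exact Or.inl (placed_add_le_sum hyL hLn hi)
    · rw [hpa, placed_append_of_mem y hj]
      exact Or.inr (placed_add_le_sum hyL hLn hj)
    · exact absurd rfl hij

/-! ### The output of Hetero-Wrap on one type -/

/-- The intervals assigned to processor `k + 1` in the state `A` are the parts in `[k, k + 1)`,
shifted by `k`, of the intervals `[start i, start i + y i)` of the tasks in `L`. -/
def IsLayout {n : ℕ} (A : WrapState n) (L : List (Fin n)) (start y : Fin n → ℝ) : Prop :=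
  ∀ i (k : ℕ) (u : ℝ), 0 ≤ u → u < 1 →
    (A.σ i (k + 1) ≤ u ∧ u < A.η i (k + 1) ↔
      i ∈ L ∧ start i ≤ u + k ∧ u + k < start i + y i)

/-- Left-to-right placement puts the tasks of `L` consecutively on the line from `0` on. -/
theorem foldl_stepLeft {n : ℕ} (y : Fin n → ℝ) (L : List (Fin n)) (hL : L.Nodup)
    (hy : ∀ i ∈ L, 0 < y i ∧ y i ≤ 1) {A : WrapState n}
    (hA : A = L.foldl (fun A i => stepLeft A i (y i)) ⟨0, 1, fun _ _ => 0, fun _ _ => 0⟩) :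
    A.p = (L.map y).sum ∧ 0 ≤ A.p ∧ (A.k : ℝ) - 1 ≤ A.p ∧ A.p ≤ A.k ∧ 1 ≤ A.k ∧
      (A.p = 0 → A.k = 1) ∧ (∀ i ∉ L, A.σ i = (fun _ => 0) ∧ A.η i = fun _ => 0) ∧
      IsLayout A L (placed y L) y := by
  induction L using List.reverseRecOn generalizing A with
  | nil =>
    subst hA
    refine ⟨by simp, by simp, by simp, by simp, by simp, by simp, by simp, ?_⟩
    intro i k u h0 h1
    simp
  | append_singleton L j ih =>
    have hLn : L.Nodup := (List.nodup_append.1 hL).1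
    have hjL : j ∉ L := fun h => (List.nodup_append.1 hL).2.2 j h j (by simp) rfl
    have hyL : ∀ i ∈ L, 0 < y i ∧ y i ≤ 1 := fun i hi => hy i (by simp [hi])
    obtain ⟨hj0, hj1⟩ := hy j (by simp)
    have hpj : placed y (L ++ [j]) j = (L.map y).sum := placed_of_split y hjL
    obtain ⟨hp, hp0, hk1, hk2, hk3, hk4, hout, hlay⟩ := ih hLn hyL rfl
    simp only [List.foldl_append, List.foldl_cons, List.foldl_nil] at hA
    set B := L.foldl (fun A i => stepLeft A i (y i)) ⟨0, 1, fun _ _ => 0, fun _ _ => 0⟩ with hB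
    have hold : ∀ i ≠ j, A.σ i = B.σ i ∧ A.η i = B.η i := by
      intro i hij
      rw [hA]
      unfold stepLeft assign
      split_ifs <;> simp [hij]
    have hnew : A.p = B.p + y j ∧ (A.k : ℝ) - 1 ≤ A.p ∧ A.p ≤ A.k ∧ 1 ≤ A.k ∧
        ∀ (k : ℕ) (u : ℝ), 0 ≤ u → u < 1 →
          (A.σ j (k + 1) ≤ u ∧ u < A.η j (k + 1) ↔ B.p ≤ u + k ∧ u + k < B.p + y j) := by
      have hσj := (hout j hjL).1
      have hηj := (hout j hjL).2
      obtain ⟨K, hK⟩ : ∃ K, B.k = K + 1 := ⟨B.k - 1, by omega⟩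
      rw [hK] at hk1 hk2 hk4
      push_cast at hk1 hk2
      rw [hA]
      unfold stepLeft assign
      split_ifs with h1 h2
      · have hK0 : K = 0 := by have := hk4 h1; omega
        subst hK0
        refine ⟨by simp [h1], by simp [hK]; linarith, by simp [hK]; linarith, by simp [hK], ?_⟩
        intro k u hu0 hu1
        simp only [hK, hσj, hηj, Function.update_self, h1]
        rcases Nat.eq_zero_or_pos k with rfl | hk
        · simp
        · have : (1 : ℝ) ≤ k := by exact_mod_cast hk
          have hne : k + 1 ≠ 0 + 1 := by omega
          simp only [Function.update_of_ne hne]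
          constructor <;> rintro ⟨_, _⟩ <;> constructor <;> linarith
      · rw [hK] at h2
        push_cast at h2
        refine ⟨by simp, by simp [hK]; linarith, by simp [hK]; linarith, by simp [hK], ?_⟩
        intro k u hu0 hu1
        simp only [hK, hσj, hηj, Function.update_self]
        rcases lt_trichotomy k K with hk | rfl | hk
        · have : (k : ℝ) + 1 ≤ K := by exact_mod_cast hk
          have hne : k + 1 ≠ K + 1 := by omega
          simp only [Function.update_of_ne hne]
          constructor <;> rintro ⟨_, _⟩ <;> constructor <;> linarith
        · simp only [Function.update_self]
          push_cast
          constructor <;> rintro ⟨_, _⟩ <;> constructor <;> linarith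
        · have : (K : ℝ) + 1 ≤ k := by exact_mod_cast hk
          have hne : k + 1 ≠ K + 1 := by omega
          simp only [Function.update_of_ne hne]
          constructor <;> rintro ⟨_, _⟩ <;> constructor <;> linarith
      · rw [hK] at h2
        push_cast at h2
        push Not at h2
        refine ⟨by simp, by simp [hK]; linarith, by simp [hK]; linarith, by simp [hK], ?_⟩
        intro k u hu0 hu1
        simp only [hK, hσj, hηj, Function.update_self]
        push_cast
        by_cases hkK : k = K
        · subst hkK
          have hne : k + 1 ≠ k + 1 + 1 := by omega
          simp only [Function.update_of_ne hne, Function.update_self]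
          constructor <;> rintro ⟨_, _⟩ <;> constructor <;> linarith
        by_cases hkK' : k = K + 1
        · subst hkK'
          simp only [Function.update_self]
          push_cast
          constructor <;> rintro ⟨_, _⟩ <;> constructor <;> linarith
        have hne1 : k + 1 ≠ K + 1 := by omega
        have hne2 : k + 1 ≠ K + 1 + 1 := by omega
        simp only [Function.update_of_ne hne1, Function.update_of_ne hne2]
        rcases lt_or_ge k K with hk | hk
        · have : (k : ℝ) + 1 ≤ K := by exact_mod_cast hk
          constructor <;> rintro ⟨_, _⟩ <;> constructor <;> linarith
        · have : (K : ℝ) + 2 ≤ k := by exact_mod_cast (by omega : K + 2 ≤ k)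
          constructor <;> rintro ⟨_, _⟩ <;> constructor <;> linarith
    obtain ⟨hAp, hA1, hA2, hA3, hA4⟩ := hnew
    refine ⟨by simp [hAp, hp], by linarith, hA1, hA2, hA3, fun h => by linarith, ?_, ?_⟩
    · intro i hi
      simp only [List.mem_append, List.mem_singleton, not_or] at hi
      rw [(hold i hi.2).1, (hold i hi.2).2]
      exact hout i hi.1
    · intro i k u hu0 hu1
      by_cases hij : i = j
      · subst hij
        rw [hA4 k u hu0 hu1, hpj, hp]
        simp
      · rw [(hold i hij).1, (hold i hij).2, hlay i k u hu0 hu1]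
        by_cases hiL : i ∈ L
        · simp [placed_append_of_mem y hiL, hiL]
        · simp [hiL, hij]

/-- Right-to-left placement puts the tasks of `L` consecutively on the line from `M` downwards. -/
theorem foldl_stepRight {n : ℕ} (M : ℕ) (y : Fin n → ℝ) (L : List (Fin n)) (hL : L.Nodup)
    (hy : ∀ i ∈ L, 0 < y i ∧ y i ≤ 1) (hM : 0 < M) (hsum : (L.map y).sum ≤ M) {A : WrapState n}
    (hA : A = L.foldl (fun A i => stepRight M A i (y i)) ⟨M, M, fun _ _ => 0, fun _ _ => 0⟩) :
    A.p = M - (L.map y).sum ∧ A.p ≤ M ∧ (A.k : ℝ) - 1 ≤ A.p ∧ A.p ≤ A.k ∧ 1 ≤ A.k ∧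
      (A.p = M → A.k = M) ∧ (∀ i ∉ L, A.σ i = (fun _ => 0) ∧ A.η i = fun _ => 0) ∧
      IsLayout A L (fun i => M - placed y L i - y i) y := by
  induction L using List.reverseRecOn generalizing A with
  | nil =>
    subst hA
    refine ⟨by simp, by simp, by simp, by simp, hM, by simp, by simp, ?_⟩
    intro i k u h0 h1
    simp
  | append_singleton L j ih =>
    have hLn : L.Nodup := (List.nodup_append.1 hL).1
    have hjL : j ∉ L := fun h => (List.nodup_append.1 hL).2.2 j h j (by simp) rfl
    have hyL : ∀ i ∈ L, 0 < y i ∧ y i ≤ 1 := fun i hi => hy i (by simp [hi])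
    obtain ⟨hj0, hj1⟩ := hy j (by simp)
    have hpj : placed y (L ++ [j]) j = (L.map y).sum := placed_of_split y hjL
    simp only [List.map_append, List.sum_append, List.map_cons, List.map_nil, List.sum_cons,
      List.sum_nil, add_zero] at hsum
    obtain ⟨hp, hp0, hk1, hk2, hk3, hk4, hout, hlay⟩ := ih hLn hyL (by linarith) rfl
    simp only [List.foldl_append, List.foldl_cons, List.foldl_nil] at hA
    set B := L.foldl (fun A i => stepRight M A i (y i)) ⟨M, M, fun _ _ => 0, fun _ _ => 0⟩ with hB
    have hold : ∀ i ≠ j, A.σ i = B.σ i ∧ A.η i = B.η i := by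
      intro i hij
      rw [hA]
      unfold stepRight assign
      split_ifs <;> simp [hij]
    have hnew : A.p = B.p - y j ∧ (A.k : ℝ) - 1 ≤ A.p ∧ A.p ≤ A.k ∧ 1 ≤ A.k ∧
        ∀ (k : ℕ) (u : ℝ), 0 ≤ u → u < 1 →
          (A.σ j (k + 1) ≤ u ∧ u < A.η j (k + 1) ↔ B.p - y j ≤ u + k ∧ u + k < B.p) := by
      have hσj := (hout j hjL).1
      have hηj := (hout j hjL).2
      obtain ⟨K, hK⟩ : ∃ K, B.k = K + 1 := ⟨B.k - 1, by omega⟩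
      rw [hK] at hk1 hk2 hk4
      push_cast at hk1 hk2
      rw [hA]
      unfold stepRight assign
      split_ifs with h1 h2
      · have hKM : M = K + 1 := by have := hk4 h1; omega
        have hKM' : (M : ℝ) = K + 1 := by exact_mod_cast hKM
        refine ⟨by simp [h1], by simp [hK]; linarith, by simp [hK]; linarith, by simp [hK], ?_⟩
        intro k u hu0 hu1
        simp only [hK, hσj, hηj, Function.update_self, h1]
        rcases lt_trichotomy k K with hk | rfl | hk
        · have : (k : ℝ) + 1 ≤ K := by exact_mod_cast hk
          have hne : k + 1 ≠ K + 1 := by omega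
          simp only [Function.update_of_ne hne]
          constructor <;> rintro ⟨_, _⟩ <;> constructor <;> linarith
        · simp only [Function.update_self]
          constructor <;> rintro ⟨_, _⟩ <;> constructor <;> linarith
        · have : (K : ℝ) + 1 ≤ k := by exact_mod_cast hk
          have hne : k + 1 ≠ K + 1 := by omega
          simp only [Function.update_of_ne hne]
          constructor <;> rintro ⟨_, _⟩ <;> constructor <;> linarith
      · rw [hK] at h2
        push_cast at h2
        refine ⟨by simp, by simp [hK]; linarith, by simp [hK]; linarith, by simp [hK], ?_⟩
        intro k u hu0 hu1
        simp only [hK, hσj, hηj, Function.update_self]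
        rcases lt_trichotomy k K with hk | rfl | hk
        · have : (k : ℝ) + 1 ≤ K := by exact_mod_cast hk
          have hne : k + 1 ≠ K + 1 := by omega
          simp only [Function.update_of_ne hne]
          constructor <;> rintro ⟨_, _⟩ <;> constructor <;> linarith
        · simp only [Function.update_self]
          push_cast
          constructor <;> rintro ⟨_, _⟩ <;> constructor <;> linarith
        · have : (K : ℝ) + 1 ≤ k := by exact_mod_cast hk
          have hne : k + 1 ≠ K + 1 := by omega
          simp only [Function.update_of_ne hne]
          constructor <;> rintro ⟨_, _⟩ <;> constructor <;> linarith
      · rw [hK] at h2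
        push_cast at h2
        push Not at h2
        -- the task ends at a nonnegative position, so there is a processor to the left
        have hKpos : 0 < K := by
          have : (0 : ℝ) < K := by linarith
          exact_mod_cast this
        obtain ⟨J, rfl⟩ : ∃ J, K = J + 1 := ⟨K - 1, by omega⟩
        push_cast at hk1 hk2 h2
        refine ⟨by simp, by simp [hK]; linarith, by simp [hK]; linarith, by simp [hK], ?_⟩
        intro k u hu0 hu1
        have hJ : J + 1 + 1 - 1 = J + 1 := rfl
        simp only [hK, hσj, hηj, Function.update_self, hJ]
        push_cast
        by_cases hkK : k = J
        · subst hkK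
          simp only [Function.update_self]
          constructor <;> rintro ⟨_, _⟩ <;> constructor <;> linarith
        by_cases hkK' : k = J + 1
        · subst hkK'
          have hne : J + 1 + 1 ≠ J + 1 := by omega
          simp only [Function.update_of_ne hne, Function.update_self]
          push_cast
          constructor <;> rintro ⟨_, _⟩ <;> constructor <;> linarith
        have hne1 : k + 1 ≠ J + 1 := by omega
        have hne2 : k + 1 ≠ J + 1 + 1 := by omega
        simp only [Function.update_of_ne hne1, Function.update_of_ne hne2]
        rcases lt_or_ge k J with hk | hk
        · have : (k : ℝ) + 1 ≤ J := by exact_mod_cast hk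
          constructor <;> rintro ⟨_, _⟩ <;> constructor <;> linarith
        · have : (J : ℝ) + 2 ≤ k := by exact_mod_cast (by omega : J + 2 ≤ k)
          constructor <;> rintro ⟨_, _⟩ <;> constructor <;> linarith
    obtain ⟨hAp, hA1, hA2, hA3, hA4⟩ := hnew
    refine ⟨by simp [hAp, hp]; ring, by linarith, hA1, hA2, hA3, fun h => by linarith, ?_, ?_⟩
    · intro i hi
      simp only [List.mem_append, List.mem_singleton, not_or] at hi
      rw [(hold i hi.2).1, (hold i hi.2).2]
      exact hout i hi.1
    · intro i k u hu0 hu1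
      by_cases hij : i = j
      · subst hij
        rw [hA4 k u hu0 hu1]
        simp [hpj, hp]
      · rw [(hold i hij).1, (hold i hij).2, hlay i k u hu0 hu1]
        by_cases hiL : i ∈ L
        · simp [placed_append_of_mem y hiL, hiL]
        · simp [hiL, hij]

/-! ### The layout of both types -/

section Layout

variable {n : ℕ} {w : Fin n → Fin 2 → ℝ}

theorem mem_taskOrder (hw : ∀ i r, 0 ≤ w i r) (hle : ∀ i, w i 0 + w i 1 ≤ 1) (i : Fin n)
    (r : Fin 2) : i ∈ taskOrder w r ↔ 0 < w i r := by
  have h0 := hw i 0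
  have h1 := hw i 1
  have hl := hle i
  simp only [taskOrder, List.mem_append, List.mem_filter, List.mem_finRange, decide_eq_true_eq,
    true_and]
  simp only [IsIMa, IsIMb, IsCP]
  fin_cases r
  · simp only [Fin.zero_eta, Fin.forall_fin_two]
    constructor
    · rintro (h | h | h)
      exacts [h.1, h.1, h.1]
    · intro h
      rcases h1.eq_or_lt with h1 | h1
      · exact Or.inr (Or.inr ⟨h, by simp, fun _ => h1.symm⟩)
      · rcases hl.eq_or_lt with hl | hl
        · exact Or.inl ⟨h, h1, hl⟩
        · exact Or.inr (Or.inl ⟨h, h1, hl⟩)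
  · simp only [Fin.mk_one, Fin.forall_fin_two]
    constructor
    · rintro (h | h | h)
      exacts [h.2.1, h.2.1, h.1]
    · intro h
      rcases h0.eq_or_lt with h0 | h0
      · exact Or.inr (Or.inr ⟨h, fun _ => h0.symm, by simp⟩)
      · rcases hl.eq_or_lt with hl | hl
        · exact Or.inl ⟨h0, h, hl⟩
        · exact Or.inr (Or.inl ⟨h0, h, hl⟩)

theorem nodup_taskOrder (w : Fin n → Fin 2 → ℝ) (r : Fin 2) : (taskOrder w r).Nodup := by
  have hf : ∀ p : Fin n → Bool, ((List.finRange n).filter p).Nodup :=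
    fun p => (List.nodup_finRange n).filter p
  unfold taskOrder
  simp only [List.nodup_append, List.mem_append, List.mem_filter, List.mem_finRange,
    decide_eq_true_eq, true_and]
  refine ⟨hf _, ⟨hf _, hf _, ?_⟩, ?_⟩
  · rintro a ha b hb rfl
    have := ha.1
    have := ha.2.1
    have h0 := hb.2 0
    have h1 := hb.2 1
    fin_cases r <;> simp at h0 h1 <;> linarith
  · rintro a ha b hb rfl
    have := ha.1
    have := ha.2.1
    have := ha.2.2
    rcases hb with hb | hb
    · have := hb.2.2
      linarith
    have h0 := hb.2 0
    have h1 := hb.2 1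
    fin_cases r <;> simp at h0 h1 <;> linarith

/-- A migrating task is preceded by the same tasks on both types, and these run on both types with
total fraction one. -/
theorem taskOrder_split (hsub : {i | IsIMb w i}.Subsingleton) {i : Fin n} (h0 : 0 < w i 0)
    (h1 : 0 < w i 1) (hle : w i 0 + w i 1 ≤ 1) :
    ∃ s : List (Fin n), (∀ j ∈ s, IsIMa w j) ∧ ∀ r, ∃ t, taskOrder w r = s ++ i :: t := by
  classical
  rcases hle.eq_or_lt with hl | hl
  · have hi : i ∈ (List.finRange n).filter (fun i => decide (IsIMa w i)) := by
      simp [IsIMa, h0, h1, hl]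
    obtain ⟨s, t, hst⟩ := List.append_of_mem hi
    refine ⟨s, fun j hj => ?_, fun r =>
      ⟨t ++ ((List.finRange n).filter (fun i => decide (IsIMb w i)) ++
        (List.finRange n).filter (fun i => decide (IsCP w r i))), ?_⟩⟩
    · have : j ∈ (List.finRange n).filter (fun i => decide (IsIMa w i)) := by
        rw [hst]; simp [hj]
      simpa using this
    · unfold taskOrder
      rw [show ((List.finRange n).filter (fun i => decide (IsIMa w i))) = s ++ i :: t by
        convert hst, List.append_assoc]
      rfl
  · have hi : i ∈ (List.finRange n).filter (fun i => decide (IsIMb w i)) := by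
      simp [IsIMb, h0, h1, hl]
    have hn : ((List.finRange n).filter (fun i => decide (IsIMb w i))).Nodup :=
      (List.nodup_finRange n).filter _
    have huniq : ∀ j ∈ (List.finRange n).filter (fun i => decide (IsIMb w i)), j = i := by
      intro j hj
      refine hsub ?_ ⟨h0, h1, hl⟩
      simpa using hj
    have hsingle : (List.finRange n).filter (fun i => decide (IsIMb w i)) = [i] := by
      obtain ⟨s, t, hst⟩ := List.append_of_mem hi
      rw [hst] at hn huniq ⊢
      have hs : s = [] := by
        refine List.eq_nil_iff_forall_not_mem.2 fun j hj => ?_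
        have := huniq j (by simp [hj])
        subst this
        exact (List.nodup_append.1 hn).2.2 _ hj _ (by simp) rfl
      have ht : t = [] := by
        refine List.eq_nil_iff_forall_not_mem.2 fun j hj => ?_
        have := huniq j (by simp [hj])
        subst this
        exact (List.nodup_cons.1 (List.nodup_append.1 hn).2.1).1 hj
      simp [hs, ht]
    refine ⟨(List.finRange n).filter (fun i => decide (IsIMa w i)), fun j hj => by simpa using hj,
      fun r => ⟨(List.finRange n).filter (fun i => decide (IsCP w r i)), ?_⟩⟩
    unfold taskOrder
    rw [show ((List.finRange n).filter (fun i => decide (IsIMb w i))) = [i] by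
      convert hsingle]
    congr!

/-- `start i r` is the left endpoint of the interval of length `w i r` that task `i` occupies on the
line `[0, m r]` of type `r`, on which processor `k` owns `[k, k + 1]`. Distinct tasks do not meet,
and positions of the same task that differ by an integer, on either type, coincide: the
task never runs on two processors at a time. -/
structure IsTaskLayout (w : Fin n → Fin 2 → ℝ) (m : Fin 2 → ℕ) (start : Fin n → Fin 2 → ℝ) :
    Prop where
  nonneg : ∀ i r, 0 ≤ start i r
  le : ∀ i r, start i r + w i r ≤ m r
  disjoint : ∀ i j r p, p ∈ Ico (start i r) (start i r + w i r) →
    p ∈ Ico (start j r) (start j r + w j r) → i = j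
  not_parallel : ∀ i r r' (k k' : ℕ) (u : ℝ),
    u + k ∈ Ico (start i r) (start i r + w i r) →
      u + k' ∈ Ico (start i r') (start i r' + w i r') → r = r' ∧ k = k'

/-- Hetero-Wrap cuts a layout of the tasks at the integers: processor `k + 1` of the algorithm gets
the positions in `[k, k + 1)`, shifted by `k`. -/
theorem exists_isTaskLayout_heteroWrap {m : Fin 2 → ℕ} (hm : ∀ r, 0 < m r)
    (hw : ∀ i r, 0 ≤ w i r) (hle : ∀ i, ∑ r, w i r ≤ 1) (hcap : ∀ r, ∑ i, w i r ≤ (m r : ℝ))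
    (hsub : {i | IsIMb w i}.Subsingleton) :
    ∃ start, IsTaskLayout w m start ∧ ∀ i r (k : ℕ) (u : ℝ), 0 ≤ u → u < 1 →
      ((heteroWrap w m r).σ i (k + 1) ≤ u ∧ u < (heteroWrap w m r).η i (k + 1) ↔
        u + k ∈ Ico (start i r) (start i r + w i r)) := by
  classical
  simp only [Fin.sum_univ_two] at hle
  have hmem := mem_taskOrder hw hle
  have hnd := nodup_taskOrder w
  have hw1 : ∀ i r, w i r ≤ 1 := by
    intro i r
    have := hle i
    have := hw i 0
    have := hw i 1
    fin_cases r <;> simp <;> linarith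
  have hy : ∀ r, ∀ i ∈ taskOrder w r, 0 < w i r ∧ w i r ≤ 1 :=
    fun r i hi => ⟨(hmem i r).1 hi, hw1 i r⟩
  have hsum : ∀ r, ((taskOrder w r).map (fun i => w i r)).sum ≤ m r := by
    intro r
    refine le_trans ?_ (hcap r)
    rw [← List.sum_toFinset _ (hnd r)]
    exact Finset.sum_le_univ_sum_of_nonneg fun i => hw i r
  have hpn : ∀ i r, 0 ≤ placed (fun i => w i r) (taskOrder w r) i :=
    fun i r => placed_nonneg _ (fun j _ => hw j r) i
  have hpl : ∀ i r, i ∈ taskOrder w r →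
      placed (fun i => w i r) (taskOrder w r) i + w i r ≤ m r := fun i r hi =>
    (placed_add_le_sum (y := fun i => w i r) (fun j _ => hw j r) (hnd r) hi).trans (hsum r)
  have hpd : ∀ i j r, i ∈ taskOrder w r → j ∈ taskOrder w r → i ≠ j →
      placed (fun i => w i r) (taskOrder w r) i + w i r ≤
          placed (fun i => w i r) (taskOrder w r) j ∨
        placed (fun i => w i r) (taskOrder w r) j + w j r ≤
          placed (fun i => w i r) (taskOrder w r) i := fun i j r hi hj hij =>
    placed_disjoint (y := fun i => w i r) (fun j _ => hw j r) (hnd r) hi hj hij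
  -- the total length of the tasks before a migrating task, on both types together, is an integer
  have hint : ∀ i, 0 < w i 0 → 0 < w i 1 → ∃ z : ℕ,
      placed (fun i => w i 0) (taskOrder w 0) i +
        placed (fun i => w i 1) (taskOrder w 1) i = z := by
    intro i h0 h1
    obtain ⟨s, hs, ht⟩ := taskOrder_split hsub h0 h1 (hle i)
    have hp : ∀ r, placed (fun i => w i r) (taskOrder w r) i = (s.map (fun i => w i r)).sum := by
      intro r
      obtain ⟨t, ht⟩ := ht r
      have := hnd r
      rw [ht] at this ⊢
      exact placed_of_split _ fun h => (List.nodup_append.1 this).2.2 i h i (by simp) rfl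
    refine ⟨s.length, ?_⟩
    rw [hp, hp, ← List.sum_map_add]
    clear hp ht
    induction s with
    | nil => simp
    | cons a s ih =>
      have ha := (hs a (by simp)).2.2
      have := ih fun j hj => hs j (by simp [hj])
      simp only [List.map_cons, List.sum_cons, List.length_cons]
      push_cast
      linarith
  have hL := foldl_stepLeft (fun i => w i 0) (taskOrder w 0) (hnd 0) (hy 0) rfl
  have hR := foldl_stepRight (m 1) (fun i => w i 1) (taskOrder w 1) (hnd 1) (hy 1) (hm 1) (hsum 1)
    rfl
  obtain ⟨-, -, -, -, -, -, -, hL⟩ := hL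
  obtain ⟨-, -, -, -, -, -, -, hR⟩ := hR
  -- a task that is not placed gets the empty interval at `0`
  let start : Fin n → Fin 2 → ℝ := fun i r =>
    if 0 < w i r then
      if r = 0 then placed (fun i => w i 0) (taskOrder w 0) i
      else m 1 - placed (fun i => w i 1) (taskOrder w 1) i - w i 1
    else 0
  have hs0 : ∀ i, 0 < w i 0 → start i 0 = placed (fun i => w i 0) (taskOrder w 0) i := by
    intro i hi
    simp [start, hi]
  have hs1 : ∀ i, 0 < w i 1 →
      start i 1 = m 1 - placed (fun i => w i 1) (taskOrder w 1) i - w i 1 := by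
    intro i hi
    simp [start, hi]
  have hpos : ∀ i r p, p ∈ Ico (start i r) (start i r + w i r) → 0 < w i r := by
    intro i r p hp
    have := hp.1.trans_lt hp.2
    linarith
  have hcross : ∀ i (k k' : ℕ) (u : ℝ), u + k ∈ Ico (start i 0) (start i 0 + w i 0) →
      u + k' ∈ Ico (start i 1) (start i 1 + w i 1) → False := by
    intro i k k' u h h'
    have h0 := hpos _ _ _ h
    have h1 := hpos _ _ _ h'
    obtain ⟨z, hz⟩ := hint i h0 h1
    rw [hs0 i h0] at h
    rw [hs1 i h1] at h'
    have := hle i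
    -- `k - k' + m 1 - z` would be an integer strictly between `0` and `1`
    have e1 : (0 : ℝ) < ((k - k' + m 1 - z : ℤ) : ℝ) := by
      push_cast
      linarith [h.1, h.2, h'.1, h'.2]
    have e2 : ((k - k' + m 1 - z : ℤ) : ℝ) < 1 := by
      push_cast
      linarith [h.1, h.2, h'.1, h'.2]
    have e3 : 0 < (k - k' + m 1 - z : ℤ) := by exact_mod_cast e1
    have e4 : (k - k' + m 1 - z : ℤ) < 1 := by exact_mod_cast e2
    omega
  refine ⟨start, ⟨?_, ?_, ?_, ?_⟩, ?_⟩
  · intro i r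
    by_cases h : 0 < w i r
    · have := hpl i r ((hmem i r).2 h)
      fin_cases r
      · simp only [Fin.zero_eta] at h ⊢
        rw [hs0 i h]
        exact hpn i 0
      · simp only [Fin.mk_one] at h this ⊢
        rw [hs1 i h]
        linarith
    · simp [start, h]
  · intro i r
    by_cases h : 0 < w i r
    · have := hpl i r ((hmem i r).2 h)
      fin_cases r
      · simp only [Fin.zero_eta] at h this ⊢
        rw [hs0 i h]
        exact this
      · simp only [Fin.mk_one] at h ⊢
        rw [hs1 i h]
        linarith [hpn i 1]
    · have : w i r = 0 := le_antisymm (not_lt.1 h) (hw i r)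
      simp [start, this]
  · intro i j r p hi hj
    have hi' := hpos _ _ _ hi
    have hj' := hpos _ _ _ hj
    by_contra hij
    have := hpd i j r ((hmem i r).2 hi') ((hmem j r).2 hj') hij
    fin_cases r
    · simp only [Fin.zero_eta] at hi hj hi' hj' this
      rw [hs0 _ hi'] at hi
      rw [hs0 _ hj'] at hj
      rcases this with h | h <;> linarith [hi.1, hi.2, hj.1, hj.2]
    · simp only [Fin.mk_one] at hi hj hi' hj' this
      rw [hs1 _ hi'] at hi
      rw [hs1 _ hj'] at hj
      rcases this with h | h <;> linarith [hi.1, hi.2, hj.1, hj.2]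
  · intro i r r' k k' u h h'
    have hsame : r = r' → k = k' := by
      rintro rfl
      have := hw1 i r
      by_contra hne
      rcases lt_or_gt_of_ne hne with hk | hk
      · have : (k : ℝ) + 1 ≤ k' := by exact_mod_cast hk
        linarith [h.1, h.2, h'.1, h'.2]
      · have : (k' : ℝ) + 1 ≤ k := by exact_mod_cast hk
        linarith [h.1, h.2, h'.1, h'.2]
    have hr : r = r' := by
      fin_cases r <;> fin_cases r'
      · rfl
      · exact (hcross i k k' u h h').elim
      · exact (hcross i k' k u h' h).elim
      · rfl
    exact ⟨hr, hsame hr⟩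
  · intro i r k u hu0 hu1
    have hout : ¬ 0 < w i r → u + k ∉ Ico (start i r) (start i r + w i r) :=
      fun h hp => h (hpos _ _ _ hp)
    fin_cases r
    · simp only [Fin.zero_eta] at hout ⊢
      have := hL i k u hu0 hu1
      rw [hmem] at this
      by_cases h : 0 < w i 0
      · rw [hs0 i h]
        simp only [h, true_and] at this
        exact this
      · simp only [h, false_and] at this
        exact iff_of_false this.1 (hout h)
    · simp only [Fin.mk_one] at hout ⊢
      have := hR i k u hu0 hu1
      rw [hmem] at this
      by_cases h : 0 < w i 1
      · rw [hs1 i h]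
        simp only [h, true_and] at this
        exact this
      · simp only [h, false_and] at this
        exact iff_of_false this.1 (hout h)

end Layout

/-! ### Functions of time with finitely many breakpoints -/

/-- `f` is constant on every closed interval that contains none of a fixed finite set of
breakpoints; the values at the breakpoints themselves are arbitrary. -/
def Stepwise {α : Type*} (f : ℝ → α) : Prop :=
  ∃ F : Finset ℝ, ∀ s t, s ≤ t → (∀ x ∈ F, x ∉ Icc s t) → f s = f t

namespace Stepwise

variable {α β : Type*}

theorem comp {f : ℝ → α} (hf : Stepwise f) (g : α → β) : Stepwise (fun t => g (f t)) := by
  obtain ⟨F, hF⟩ := hf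
  exact ⟨F, fun s t hst h => congrArg g (hF s t hst h)⟩

theorem pi {ι : Type*} [Finite ι] {α : ι → Type*} {f : (i : ι) → ℝ → α i}
    (hf : ∀ i, Stepwise (f i)) : Stepwise (fun t i => f i t) := by
  classical
  cases nonempty_fintype ι
  choose F hF using hf
  refine ⟨Finset.univ.biUnion F, fun s t hst h => funext fun i => hF i s t hst fun x hx => ?_⟩
  exact h x (Finset.mem_biUnion.2 ⟨i, Finset.mem_univ i, hx⟩)

theorem prodMk {f : ℝ → α} {g : ℝ → β} (hf : Stepwise f) (hg : Stepwise g) :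
    Stepwise (fun t => (f t, g t)) := by
  classical
  obtain ⟨F, hF⟩ := hf
  obtain ⟨G, hG⟩ := hg
  refine ⟨F ∪ G, fun s t hst h => Prod.ext (hF s t hst fun x hx => h x ?_)
    (hG s t hst fun x hx => h x ?_)⟩ <;> simp [hx]

theorem mem_Ico (a b : ℝ) : Stepwise (fun t => t ∈ Ico a b) := by
  refine ⟨{a, b}, fun s t hst h => propext ?_⟩
  have ha := h a (by simp)
  have hb := h b (by simp)
  simp only [mem_Icc, not_and_or, not_le] at ha hb
  constructor <;> rintro ⟨h1, h2⟩ <;> constructor <;> rcases ha with ha | ha <;>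
    rcases hb with hb | hb <;> linarith

theorem and {p q : ℝ → Prop} (hp : Stepwise p) (hq : Stepwise q) :
    Stepwise (fun t => p t ∧ q t) :=
  (hp.prodMk hq).comp fun z => z.1 ∧ z.2

theorem finset_sum {ι : Type*} [Fintype ι] {f : ι → ℝ → ℝ} (hf : ∀ i, Stepwise (f i)) :
    Stepwise (fun t => ∑ i, f i t) :=
  (Stepwise.pi hf).comp fun z => ∑ i, z i

theorem mul {f g : ℝ → ℝ} (hf : Stepwise f) (hg : Stepwise g) : Stepwise (fun t => f t * g t) :=
  (hf.prodMk hg).comp fun z => z.1 * z.2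

/-- A stepwise function factors through a map to a finite type whose fibres are intervals. -/
theorem exists_factor {f : ℝ → α} (hf : Stepwise f) :
    ∃ (p : ℕ) (g : ℝ → Fin p) (φ : Fin p → α),
      (∀ j, (g ⁻¹' {j}).OrdConnected) ∧ ∀ t, f t = φ (g t) := by
  classical
  obtain ⟨F, hF⟩ := hf
  -- the position of `t` relative to `F`: the numbers of breakpoints `< t` and `≤ t`
  let lt : ℝ → Fin (F.card + 1) := fun t =>
    ⟨(F.filter (· < t)).card, Nat.lt_succ_of_le (Finset.card_filter_le _ _)⟩
  let le : ℝ → Fin (F.card + 1) := fun t =>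
    ⟨(F.filter (· ≤ t)).card, Nat.lt_succ_of_le (Finset.card_filter_le _ _)⟩
  have hlt : Monotone lt := fun s t hst => by
    refine Finset.card_le_card fun x hx => ?_
    simp only [Finset.mem_filter] at hx ⊢
    exact ⟨hx.1, hx.2.trans_le hst⟩
  have hle : Monotone le := fun s t hst => by
    refine Finset.card_le_card fun x hx => ?_
    simp only [Finset.mem_filter] at hx ⊢
    exact ⟨hx.1, hx.2.trans hst⟩
  let g : ℝ → Fin ((F.card + 1) * (F.card + 1)) := fun t => finProdFinEquiv (lt t, le t)
  have hg : ∀ s t, g s = g t ↔ lt s = lt t ∧ le s = le t := fun s t => by simp [g]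
  have key : ∀ s t, s ≤ t → g s = g t → f s = f t := by
    intro s t hst h
    rcases hst.eq_or_lt with rfl | hst'
    · rfl
    obtain ⟨h1, h2⟩ := (hg s t).1 h
    refine hF s t hst fun x hx hxst => ?_
    rcases hxst.2.eq_or_lt with rfl | hxt
    · -- a breakpoint `x = t > s` is counted by `le t` only
      have hss : F.filter (· ≤ s) ⊂ F.filter (· ≤ x) := by
        refine (Finset.ssubset_iff_of_subset fun y hy => ?_).2 ⟨x, by simp [hx], by simp [hst']⟩
        simp only [Finset.mem_filter] at hy ⊢
        exact ⟨hy.1, hy.2.trans hst⟩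
      exact (Finset.card_lt_card hss).ne (congrArg Fin.val h2)
    · have hss : F.filter (· < s) ⊂ F.filter (· < t) := by
        refine (Finset.ssubset_iff_of_subset fun y hy => ?_).2
          ⟨x, by simp [hx, hxt], by simp [hxst.1]⟩
        simp only [Finset.mem_filter] at hy ⊢
        exact ⟨hy.1, hy.2.trans_le hst⟩
      exact (Finset.card_lt_card hss).ne (congrArg Fin.val h1)
  refine ⟨_, g, fun j => if h : ∃ t, g t = j then f h.choose else f 0, fun j => ⟨?_⟩, fun t => ?_⟩
  · rintro s hs t ht x ⟨hsx, hxt⟩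
    simp only [mem_preimage, mem_singleton_iff] at hs ht ⊢
    obtain ⟨h1, h2⟩ := (hg s t).1 (hs.trans ht.symm)
    rw [← hs, hg]
    exact ⟨le_antisymm ((hlt hxt).trans_eq h1.symm) (hlt hsx),
      le_antisymm ((hle hxt).trans_eq h2.symm) (hle hsx)⟩
  · have h : ∃ t', g t' = g t := ⟨t, rfl⟩
    simp only [h, dite_true]
    rcases le_total t h.choose with hle | hle
    · exact key _ _ hle h.choose_spec.symm
    · exact (key _ _ hle h.choose_spec).symm

theorem isIntervalStepOn {f : ℝ → ℝ} (hf : Stepwise f) {X : Set ℝ} (hX : X.OrdConnected) :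
    IsIntervalStepOn f X := by
  obtain ⟨p, g, φ, hg, hφ⟩ := hf.exists_factor
  refine ⟨p, fun j => g ⁻¹' {j} ∩ X, φ, fun j => (hg j).inter hX, fun i j hij => ?_, ?_, ?_⟩
  · refine Set.disjoint_left.2 fun t hi hj => hij ?_
    exact hi.1.symm.trans hj.1
  · ext t
    simp
  · rintro j t ⟨rfl, -⟩
    exact hφ t

theorem isStepOn {f : ℝ → ℝ} (hf : Stepwise f) {X : Set ℝ} (hX : X.OrdConnected) :
    IsStepOn f X := by
  obtain ⟨p, part, φ, -, h⟩ := hf.isIntervalStepOn hX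
  exact ⟨p, part, φ, h⟩

theorem intervalIntegrable {f : ℝ → ℝ} (hf : Stepwise f) (a b : ℝ) :
    IntervalIntegrable f volume a b := by
  obtain ⟨p, g, φ, hg, hφ⟩ := hf.exists_factor
  have hgm : Measurable g := measurable_to_countable' fun j => (hg j).measurableSet
  have hfm : Measurable f := by
    have : f = φ ∘ g := funext hφ
    rw [this]
    exact (measurable_of_finite φ).comp hgm
  refine (intervalIntegrable_const (c := ∑ j, |φ j|)).mono_fun hfm.aestronglyMeasurable ?_
  refine Filter.Eventually.of_forall fun t => ?_
  simp only [hφ, Real.norm_eq_abs]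
  refine (Finset.single_le_sum (f := fun j => |φ j|) (fun j _ => abs_nonneg _)
    (Finset.mem_univ (g t))).trans (le_abs_self _)

end Stepwise

/-- An interval `[A, B)` of the line `[0, m]`, cut at the integers and scaled to the time interval
`[T, T']`, takes total time `(T' - T) * (B - A)` on the `m` processors. -/
theorem sum_integral_indicator_position {T T' A B : ℝ} {m : ℕ} (hT : T < T') (hA : 0 ≤ A)
    (hAB : A ≤ B) (hB : B ≤ m) :
    ∑ k : Fin m, ∫ t in T..T',
        (Ico A B).indicator (fun _ => (1 : ℝ)) ((t - T) / (T' - T) + (k : ℕ)) =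
      (T' - T) * (B - A) := by
  have hh : 0 < T' - T := sub_pos.2 hT
  set g : ℝ → ℝ := (Ico A B).indicator (fun _ => (1 : ℝ)) with hg
  have hgi : ∀ a b, IntervalIntegrable g volume a b := by
    intro a b
    have : Stepwise g := by
      classical
      have := (Stepwise.mem_Ico A B).comp (fun p => if p then (1 : ℝ) else 0)
      refine (funext fun x => ?_ : g = _) ▸ this
      rw [hg, Set.indicator_apply]
      congr
    exact this.intervalIntegrable a b
  have h1 : ∀ k : Fin m, ∫ t in T..T', g ((t - T) / (T' - T) + (k : ℕ)) =
      (T' - T) * ∫ x in ((k : ℕ) : ℝ)..((k : ℕ) + 1 : ℕ), g x := by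
    intro k
    have e : ∀ t, g ((t - T) / (T' - T) + (k : ℕ)) =
        g (t / (T' - T) + ((k : ℕ) - T / (T' - T))) := fun t => by
      congr 1
      ring
    simp only [e]
    rw [intervalIntegral.integral_comp_div_add _ hh.ne', smul_eq_mul]
    congr 2
    · ring
    · push_cast
      field_simp
      ring
  simp only [h1]
  rw [← Finset.mul_sum, Fin.sum_univ_eq_sum_range
    (fun k => ∫ x in (k : ℝ)..((k + 1 : ℕ) : ℝ), g x) m,
    intervalIntegral.sum_integral_adjacent_intervals (a := fun k : ℕ => (k : ℝ))
      (fun k _ => hgi _ _)]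
  congr 1
  rw [intervalIntegral.integral_of_le (by simp), hg,
    MeasureTheory.integral_indicator measurableSet_Ico, Measure.restrict_restrict measurableSet_Ico]
  have : (Ico A B ∩ Ioc ((0 : ℕ) : ℝ) m : Set ℝ) =ᵐ[volume] Ico A B := by
    have hsub : Ico A B ⊆ Icc ((0 : ℕ) : ℝ) m := fun x hx =>
      ⟨by push_cast; exact hA.trans hx.1, hx.2.le.trans hB⟩
    have h2 := (Filter.EventuallyEq.refl (ae volume) (Ico A B)).inter
      (Ioc_ae_eq_Icc (μ := volume) (a := ((0 : ℕ) : ℝ)) (b := m))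
    rwa [inter_eq_left.2 hsub] at h2
  rw [Measure.restrict_congr_set this]
  simp [hAB]

/-! ### Partial sums of the pieces of a task -/

/-- Total length of the first `k` of the pieces of lengths `o`. -/
noncomputable def offset {l : ℕ} (o : Fin l → ℝ) (k : ℕ) : ℝ :=
  ∑ j ∈ Finset.range k, if h : j < l then o ⟨j, h⟩ else 0

section offset

variable {l : ℕ} {o : Fin l → ℝ}

theorem offset_zero : offset o 0 = 0 := by simp [offset]

theorem offset_succ (q : Fin l) : offset o (q + 1) = offset o q + o q := by
  simp [offset, Finset.sum_range_succ]

theorem offset_length : offset o l = ∑ q, o q := by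
  unfold offset
  rw [← Fin.sum_univ_eq_sum_range (fun j => if h : j < l then o ⟨j, h⟩ else 0)]
  simp

theorem offset_mono (ho : ∀ q, 0 ≤ o q) : Monotone (offset o) := by
  refine monotone_nat_of_le_succ fun k => ?_
  unfold offset
  rw [Finset.sum_range_succ]
  split_ifs with h
  · linarith [ho ⟨k, h⟩]
  · simp

theorem mem_Ico_offset_iff (ho : ∀ q, 0 ≤ o q) (a p : ℝ) :
    p ∈ Ico a (a + ∑ q, o q) ↔ ∃ q : Fin l, p ∈ Ico (a + offset o q) (a + offset o (q + 1)) := by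
  have hmono := offset_mono ho
  constructor
  · rintro ⟨h1, h2⟩
    rw [← offset_length] at h2
    classical
    have hex : ∃ k, p < a + offset o k := ⟨l, h2⟩
    have hle : Nat.find hex ≤ l := Nat.find_min' hex h2
    have hpos : Nat.find hex ≠ 0 := by
      intro h0
      have := Nat.find_spec hex
      rw [h0, offset_zero] at this
      linarith
    obtain ⟨k, hk⟩ := Nat.exists_eq_succ_of_ne_zero hpos
    refine ⟨⟨k, by omega⟩, ?_, ?_⟩
    · exact not_lt.1 (Nat.find_min hex (by omega : k < Nat.find hex))
    · have := Nat.find_spec hex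
      rwa [hk] at this
  · rintro ⟨q, h1, h2⟩
    have e1 := hmono (Nat.zero_le q)
    have e2 := hmono (Nat.succ_le_of_lt q.2)
    rw [offset_zero] at e1
    rw [Nat.succ_eq_add_one, offset_length] at e2
    exact ⟨by linarith, by linarith⟩

theorem offset_unique (ho : ∀ q, 0 ≤ o q) {a p : ℝ} {q q' : Fin l}
    (h : p ∈ Ico (a + offset o q) (a + offset o (q + 1)))
    (h' : p ∈ Ico (a + offset o q') (a + offset o (q' + 1))) : q = q' := by
  have hmono := offset_mono ho
  by_contra hne
  rcases lt_or_gt_of_ne hne with hlt | hlt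
  · have := hmono (Nat.succ_le_of_lt hlt)
    rw [Nat.succ_eq_add_one] at this
    linarith [h.2, h'.1]
  · have := hmono (Nat.succ_le_of_lt hlt)
    rw [Nat.succ_eq_add_one] at this
    linarith [h'.2, h.1]

end offset

/-! ### The major grid -/

section Grid

variable {n N : ℕ} {P : Instance n} {τ : Fin (N + 1) → ℝ}

theorem deadline_pos (i : Fin n) : 0 < P.deadline i :=
  add_pos_of_nonneg_of_pos (P.b_nonneg i) (P.d_pos i)

theorem b_lt_deadline (i : Fin n) : P.b i < P.deadline i :=
  lt_add_of_pos_right _ (P.d_pos i)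

theorem minExec_nonneg (i : Fin n) : 0 ≤ P.minExec i :=
  div_nonneg (P.c_nonneg i) P.fmax_pos.le

theorem deadline_le_horizon (i : Fin n) : P.deadline i ≤ P.horizon :=
  le_ciSup (Set.finite_range _).bddAbove i

namespace Instance.IsMajorGrid

theorem exists_eq_b (hτ : P.IsMajorGrid τ) (i : Fin n) : ∃ μ, τ μ = P.b i := by
  have : P.b i ∈ range τ := by rw [hτ.range_eq]; simp
  exact this

theorem exists_eq_deadline (hτ : P.IsMajorGrid τ) (i : Fin n) : ∃ μ, τ μ = P.deadline i := by
  have : P.deadline i ∈ range τ := by rw [hτ.range_eq]; simp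
  exact this

theorem mem_cases (hτ : P.IsMajorGrid τ) (μ : Fin (N + 1)) :
    τ μ = 0 ∨ (∃ i, P.b i = τ μ) ∨ ∃ i, P.deadline i = τ μ := by
  have : τ μ ∈ range τ := ⟨μ, rfl⟩
  rw [hτ.range_eq] at this
  rcases this with (h | h) | h
  exacts [Or.inl h, Or.inr (Or.inl h), Or.inr (Or.inr h)]

theorem zero_eq (hτ : P.IsMajorGrid τ) : τ 0 = 0 := by
  apply le_antisymm
  · have : (0 : ℝ) ∈ range τ := by rw [hτ.range_eq]; simp
    obtain ⟨μ, hμ⟩ := this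
    rw [← hμ]
    exact hτ.strictMono.monotone (Fin.zero_le μ)
  · rcases hτ.mem_cases 0 with h | ⟨i, h⟩ | ⟨i, h⟩
    · rw [h]
    · rw [← h]; exact P.b_nonneg i
    · rw [← h]; exact (deadline_pos i).le

theorem nonneg (hτ : P.IsMajorGrid τ) (μ : Fin (N + 1)) : 0 ≤ τ μ :=
  hτ.zero_eq ▸ hτ.strictMono.monotone (Fin.zero_le μ)

theorem le_horizon (hτ : P.IsMajorGrid τ) (μ : Fin (N + 1)) : τ μ ≤ P.horizon := by
  rcases hτ.mem_cases μ with h | ⟨i, h⟩ | ⟨i, h⟩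
  · rw [h]
    exact Real.iSup_nonneg fun i => (deadline_pos i).le
  · rw [← h]; exact (b_lt_deadline i).le.trans (deadline_le_horizon i)
  · rw [← h]; exact deadline_le_horizon i

theorem deadline_le_last (hτ : P.IsMajorGrid τ) (i : Fin n) : P.deadline i ≤ τ (Fin.last N) := by
  obtain ⟨μ, hμ⟩ := hτ.exists_eq_deadline i
  rw [← hμ]
  exact hτ.strictMono.monotone (Fin.le_last μ)

theorem gridStep_pos (hτ : P.IsMajorGrid τ) (μ : Fin N) : 0 < gridStep τ μ :=
  sub_pos.2 (hτ.strictMono Fin.castSucc_lt_succ)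

theorem interval_unique (hτ : P.IsMajorGrid τ) {μ μ' : Fin N} {t : ℝ}
    (h : t ∈ Ico (τ μ.castSucc) (τ μ.succ)) (h' : t ∈ Ico (τ μ'.castSucc) (τ μ'.succ)) :
    μ = μ' := by
  by_contra hne
  rcases lt_or_gt_of_ne hne with hlt | hlt
  · have : τ μ.succ ≤ τ μ'.castSucc := hτ.strictMono.monotone (Fin.succ_le_castSucc_iff.2 hlt)
    linarith [h.2, h'.1]
  · have : τ μ'.succ ≤ τ μ.castSucc := hτ.strictMono.monotone (Fin.succ_le_castSucc_iff.2 hlt)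
    linarith [h'.2, h.1]

end Instance.IsMajorGrid

end Grid

/-! ### Schedules from pieces of tasks -/

section Schedule

variable {n N : ℕ} {P : Instance n} {τ : Fin (N + 1) → ℝ} {l : Fin 2 → ℕ}

open Classical in
/-- In the `μ`-th interval of the grid, task `i` is divided on type `r` into pieces
`q : Fin (l r)` that take the fractions `ω i r q μ` of the interval and run at speeds `v i r q μ`;
`Z i r k q μ t` says that piece `q` runs on processor `k` at time `t`. The assignment `a` and the
speeds `s` are the ones described by these pieces. -/
structure IsPieceSchedule (P : Instance n) (τ : Fin (N + 1) → ℝ)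
    (ω v : Fin n → (r : Fin 2) → Fin (l r) → Fin N → ℝ)
    (a : Fin n → (r : Fin 2) → Fin (P.m r) → ℝ → ℝ) (s : (r : Fin 2) → Fin (P.m r) → ℝ → ℝ)
    (Z : Fin n → (r : Fin 2) → Fin (P.m r) → Fin (l r) → Fin N → ℝ → Prop) : Prop where
  mem_interval : ∀ {i r k q μ t}, Z i r k q μ t → t ∈ Ico (τ μ.castSucc) (τ μ.succ)
  assign_eq : ∀ i r k t, a i r k t = if ∃ μ q, Z i r k q μ t then 1 else 0
  speed_eq : ∀ {i r k q μ t}, Z i r k q μ t → s r k t = v i r q μ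
  task_piece_unique : ∀ {i j r k q q' μ t}, Z i r k q μ t → Z j r k q' μ t → i = j ∧ q = q'
  proc_unique : ∀ {i r r' k k' q q' μ t}, Z i r k q μ t → Z i r' k' q' μ t →
    (⟨r, k⟩ : (r : Fin 2) × Fin (P.m r)) = ⟨r', k'⟩
  stepwise_run : ∀ i r k q μ, Stepwise (Z i r k q μ)
  stepwise_speed : ∀ r k, Stepwise (s r k)
  integral_run : ∀ i r q μ, ∑ k, ∫ t in (τ μ.castSucc)..(τ μ.succ),
    (if Z i r k q μ t then (1 : ℝ) else 0) = gridStep τ μ * ω i r q μ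

/-- The pieces of a task are placed consecutively in the interval that Hetero-Wrap gives to the
task. -/
theorem exists_isPieceSchedule_wrapAssignment (hτ : P.IsMajorGrid τ)
    {ω v : Fin n → (r : Fin 2) → Fin (l r) → Fin N → ℝ} {S : Fin 2 → Set ℝ}
    (hS : ∀ r, (S r).Nonempty) (hv : ∀ i r q μ, v i r q μ ∈ S r) (hω : ∀ i r q μ, 0 ≤ ω i r q μ)
    (htask : ∀ i μ, ∑ r, ∑ q, ω i r q μ ≤ 1)
    (hcap : ∀ r μ, ∑ i, ∑ q, ω i r q μ ≤ (P.m r : ℝ))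
    (hone : AtMostOneInterCluster (totalWork ω)) :
    ∃ s Z, IsPieceSchedule P τ ω v (wrapAssignment P.m τ (totalWork ω)) s Z ∧
      ∀ r k t, s r k t ∈ S r := by
  classical
  have hlay : ∀ μ, _ := fun μ => exists_isTaskLayout_heteroWrap (w := fun i r => totalWork ω i r μ)
    P.m_pos (fun i r => Finset.sum_nonneg fun q _ => hω i r q μ) (fun i => htask i μ)
    (fun r => hcap r μ) (hone μ)
  choose start hstart hwrap using hlay
  -- position at time `t` on the line of processor `k`
  let pos : Fin N → ℕ → ℝ → ℝ := fun μ k t => (t - τ μ.castSucc) / (τ μ.succ - τ μ.castSucc) + k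
  let cut : Fin n → (r : Fin 2) → Fin N → ℕ → ℝ := fun i r μ q =>
    start μ i r + offset (fun q => ω i r q μ) q
  let Z : Fin n → (r : Fin 2) → Fin (P.m r) → Fin (l r) → Fin N → ℝ → Prop :=
    fun i r k q μ t => t ∈ Ico (τ μ.castSucc) (τ μ.succ) ∧
      pos μ k t ∈ Ico (cut i r μ q) (cut i r μ (q + 1))
  have hpos : ∀ i r μ p, (∃ q : Fin (l r), p ∈ Ico (cut i r μ q) (cut i r μ (q + 1))) ↔
      p ∈ Ico (start μ i r) (start μ i r + totalWork ω i r μ) :=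
    fun i r μ p => (mem_Ico_offset_iff (fun q => hω i r q μ) _ p).symm
  have hZstart : ∀ {i r k q μ t}, Z i r k q μ t →
      pos μ k t ∈ Ico (start μ i r) (start μ i r + totalWork ω i r μ) :=
    fun {i r k q μ t} h => (hpos i r μ _).1 ⟨q, h.2⟩
  have hunique : ∀ {i j r k q q' μ t}, Z i r k q μ t → Z j r k q' μ t → i = j ∧ q = q' := by
    intro i j r k q q' μ t h h'
    have hij := (hstart μ).disjoint i j r _ (hZstart h) (hZstart h')
    subst hij
    exact ⟨rfl, offset_unique (fun q => hω i r q μ) h.2 h'.2⟩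
  have hstepZ : ∀ i r k q μ, Stepwise (Z i r k q μ) := by
    intro i r k q μ
    have hh : 0 < τ μ.succ - τ μ.castSucc := hτ.gridStep_pos μ
    set h := τ μ.succ - τ μ.castSucc with hdef
    refine (Stepwise.mem_Ico _ _).and ?_
    convert Stepwise.mem_Ico (τ μ.castSucc + (cut i r μ q - (k : ℕ)) * h)
      (τ μ.castSucc + (cut i r μ (q + 1) - (k : ℕ)) * h) using 2 with t
    have e : pos μ k t = (t - τ μ.castSucc) / h + (k : ℕ) := rfl
    have e1 : ∀ c : ℝ, c ≤ pos μ k t ↔ τ μ.castSucc + (c - (k : ℕ)) * h ≤ t := by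
      intro c
      rw [e, ← sub_le_iff_le_add, le_div_iff₀ hh]
      constructor <;> intro _ <;> linarith
    simp only [mem_Ico, ← not_le, e1]
  let speed : (r : Fin 2) → (Fin n × Fin (l r) × Fin N → Prop) → ℝ := fun r p =>
    if h : ∃ z, p z then v h.choose.1 r h.choose.2.1 h.choose.2.2 else (hS r).some
  let s : (r : Fin 2) → Fin (P.m r) → ℝ → ℝ := fun r k t =>
    speed r fun z => Z z.1 r k z.2.1 z.2.2 t
  have hs : ∀ {i r k q μ t}, Z i r k q μ t → s r k t = v i r q μ := by
    intro i r k q μ t hz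
    have h : ∃ z : Fin n × Fin (l r) × Fin N, Z z.1 r k z.2.1 z.2.2 t := ⟨(i, q, μ), hz⟩
    have hval : s r k t = v h.choose.1 r h.choose.2.1 h.choose.2.2 := dif_pos h
    have hc := h.choose_spec
    rw [hval]
    generalize h.choose = z at hc
    obtain ⟨j, q', μ'⟩ := z
    obtain rfl := hτ.interval_unique hz.1 hc.1
    obtain ⟨rfl, rfl⟩ := hunique hz hc
    rfl
  refine ⟨s, Z, ⟨fun h => h.1, ?_, hs, hunique, ?_, hstepZ, ?_, ?_⟩, ?_⟩
  · intro i r k t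
    unfold wrapAssignment
    congr 1
    refine propext (exists_congr fun μ => ?_)
    have hh := hτ.gridStep_pos μ
    have key : t ∈ Ico (τ μ.castSucc) (τ μ.succ) →
        (((heteroWrap (fun i r => totalWork ω i r μ) P.m r).σ i (k + 1) * gridStep τ μ ≤
            t - τ μ.castSucc ∧
          t - τ μ.castSucc <
            (heteroWrap (fun i r => totalWork ω i r μ) P.m r).η i (k + 1) * gridStep τ μ) ↔
          pos μ k t ∈ Ico (start μ i r) (start μ i r + totalWork ω i r μ)) := by
      intro ht
      have hu0 : 0 ≤ (t - τ μ.castSucc) / gridStep τ μ := div_nonneg (sub_nonneg.2 ht.1) hh.le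
      have hu1 : (t - τ μ.castSucc) / gridStep τ μ < 1 := by
        rw [div_lt_one hh]
        exact sub_lt_sub_right ht.2 _
      refine Iff.trans ?_ (hwrap μ i r k _ hu0 hu1)
      rw [← le_div_iff₀ hh, ← div_lt_iff₀ hh]
      rfl
    constructor
    · rintro ⟨ht, h⟩
      obtain ⟨q, hq⟩ := (hpos i r μ _).2 ((key ht).1 h)
      exact ⟨q, ht, hq⟩
    · rintro ⟨q, hq⟩
      exact ⟨hq.1, (key hq.1).2 (hZstart hq)⟩
  · intro i r r' k k' q q' μ t h h'
    obtain ⟨rfl, hk⟩ := (hstart μ).not_parallel i r r' k k' _ (hZstart h) (hZstart h')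
    rw [Fin.ext hk]
  · intro r k
    exact (Stepwise.pi fun z : Fin n × Fin (l r) × Fin N => hstepZ z.1 r k z.2.1 z.2.2).comp
      (speed r)
  · intro i r q μ
    have hlt : τ μ.castSucc < τ μ.succ := sub_pos.1 (hτ.gridStep_pos μ)
    have hmono := offset_mono (o := fun q => ω i r q μ) fun q => hω i r q μ
    have hA : 0 ≤ cut i r μ q := by
      have h1 := hmono (Nat.zero_le q)
      rw [offset_zero] at h1
      exact add_nonneg ((hstart μ).nonneg i r) h1
    have hAB : cut i r μ q ≤ cut i r μ (q + 1) := add_le_add_right (hmono (Nat.le_succ _)) _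
    have hB : cut i r μ (q + 1) ≤ P.m r := by
      refine le_trans (add_le_add_right (hmono (Nat.succ_le_of_lt q.2)) _) ?_
      rw [offset_length]
      exact (hstart μ).le i r
    have hsum := sum_integral_indicator_position hlt hA hAB hB
    have hdiff : cut i r μ (q + 1) - cut i r μ q = ω i r q μ := by
      simp only [cut, offset_succ]
      ring
    rw [hdiff] at hsum
    unfold gridStep
    rw [← hsum]
    refine Finset.sum_congr rfl fun k _ => ?_
    -- the right endpoint, where no task runs, is a null set
    rw [intervalIntegral.integral_of_le hlt.le, intervalIntegral.integral_of_le hlt.le,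
      ← MeasureTheory.integral_Ico_eq_integral_Ioc, ← MeasureTheory.integral_Ico_eq_integral_Ioc]
    refine setIntegral_congr_fun measurableSet_Ico fun t ht => ?_
    simp only [Z, Set.indicator_apply, ht, true_and]
    rfl
  · intro r k t
    by_cases h : ∃ z : Fin n × Fin (l r) × Fin N, Z z.1 r k z.2.1 z.2.2 t
    · rw [hs h.choose_spec]
      exact hv _ _ _ _
    · have : s r k t = (hS r).some := dif_neg h
      rw [this]
      exact (hS r).some_mem

end Schedule

end HeteroSched

/-! ### States that complete a schedule -/

theorem AbsolutelyContinuousOnInterval.congr {f g : ℝ → ℝ} {a b : ℝ}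
    (hf : AbsolutelyContinuousOnInterval f a b) (hfg : EqOn f g (uIcc a b)) :
    AbsolutelyContinuousOnInterval g a b := by
  rw [absolutelyContinuousOnInterval_iff] at hf ⊢
  intro ε hε
  obtain ⟨δ, hδ, h⟩ := hf ε hε
  refine ⟨δ, hδ, fun E hE hlt => ?_⟩
  have := h E hE hlt
  rwa [Finset.sum_congr rfl fun i hi => by rw [hfg (hE.1 i hi).1, hfg (hE.1 i hi).2]] at this

namespace HeteroSched

theorem integral_congr_Ico {f g : ℝ → ℝ} {a b : ℝ} (hab : a ≤ b) (h : ∀ t ∈ Ico a b, f t = g t) :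
    ∫ t in a..b, f t = ∫ t in a..b, g t := by
  rw [intervalIntegral.integral_of_le hab, intervalIntegral.integral_of_le hab,
    ← MeasureTheory.integral_Ico_eq_integral_Ioc, ← MeasureTheory.integral_Ico_eq_integral_Ioc]
  exact setIntegral_congr_fun measurableSet_Ico h

theorem sum_zero_one_le_one {ι : Type*} [Fintype ι] {f : ι → ℝ} (h01 : ∀ i, f i = 0 ∨ f i = 1)
    (huniq : ∀ i j, f i = 1 → f j = 1 → i = j) : ∑ i, f i ≤ 1 := by
  by_cases h : ∃ i, f i = 1
  · obtain ⟨i, hi⟩ := h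
    rw [Finset.sum_eq_single i, hi]
    · intro j _ hj
      exact (h01 j).resolve_right fun hj1 => hj (huniq j i hj1 hi)
    · simp
  · push Not at h
    rw [Finset.sum_eq_zero fun i _ => (h01 i).resolve_right (h i)]
    exact zero_le_one

/-- State plus work done so far does not decrease. -/
theorem monotone_add_work {N : ℕ} {x W : Fin (N + 1) → ℝ}
    (h : ∀ μ : Fin N, x μ.castSucc - (W μ.succ - W μ.castSucc) ≤ x μ.succ) :
    Monotone fun μ => x μ + W μ :=
  Fin.monotone_iff_le_succ.2 fun μ => by linarith [h μ]

section Schedule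

variable {n N : ℕ} {P : Instance n} {τ : Fin (N + 1) → ℝ} {l : Fin 2 → ℕ}

/-- Rate at which the assignment `a` with the speeds `s` works on task `i`. -/
noncomputable def workRate (a : Fin n → (r : Fin 2) → Fin (P.m r) → ℝ → ℝ)
    (s : (r : Fin 2) → Fin (P.m r) → ℝ → ℝ) (i : Fin n) (t : ℝ) : ℝ :=
  ∑ r, ∑ k, a i r k t * s r k t

/-- If the work done in the window of each task is at least its minimum execution time, then there
are states that complete the schedule: the decrease of `x i` is the work, scaled by the ratio of
the minimum execution time to the work done in the window. -/
theorem exists_state {a : Fin n → (r : Fin 2) → Fin (P.m r) → ℝ → ℝ}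
    {s : (r : Fin 2) → Fin (P.m r) → ℝ → ℝ} (hstep : ∀ i, Stepwise (workRate a s i))
    (hnonneg : ∀ i t, 0 ≤ workRate a s i t)
    (hwork : ∀ i, P.minExec i ≤ ∫ t in (P.b i)..(P.deadline i), workRate a s i t) :
    ∃ X : Fin n → ℝ → ℝ, (∀ i, X i (P.b i) = P.minExec i) ∧
      (∀ i, ∀ t ∉ P.window i, X i t = 0) ∧
      (∀ i, AbsolutelyContinuousOnInterval (X i) (P.b i) (P.deadline i)) ∧
      ∀ i, ∀ᵐ t, DifferentiableAt ℝ (X i) t ∧ -workRate a s i t ≤ deriv (X i) t := by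
  classical
  let W : Fin n → ℝ := fun i => ∫ t in (P.b i)..(P.deadline i), workRate a s i t
  let θ : Fin n → ℝ := fun i => P.minExec i / W i
  have hW : ∀ i, 0 ≤ W i := fun i => (minExec_nonneg i).trans (hwork i)
  have hθ1 : ∀ i, θ i ≤ 1 := fun i => div_le_one_of_le₀ (hwork i) (hW i)
  have hθ : ∀ i, θ i * W i = P.minExec i := by
    intro i
    by_cases h : W i = 0
    · -- with no work at all, the task has no required cycles
      have := hwork i
      have h' := minExec_nonneg (P := P) i
      rw [h, mul_zero]
      exact le_antisymm h' (this.trans_eq h)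
    · exact div_mul_cancel₀ _ h
  let Y : Fin n → ℝ → ℝ := fun i t =>
    P.minExec i - θ i * ∫ x in (P.b i)..t, workRate a s i x
  let X : Fin n → ℝ → ℝ := fun i t => if t ∈ Icc (P.b i) (P.deadline i) then Y i t else 0
  have hlt : ∀ i, P.b i < P.deadline i := b_lt_deadline
  refine ⟨X, fun i => ?_, fun i t ht => ?_, fun i => ?_, fun i => ?_⟩
  · simp [X, Y, (hlt i).le]
  · by_cases h : t ∈ Icc (P.b i) (P.deadline i)
    · have htd : t = P.deadline i := by
        by_contra hne
        exact ht ⟨h.1, lt_of_le_of_ne h.2 hne⟩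
      simp only [X, h, if_true]
      rw [htd]
      exact sub_eq_zero.2 (hθ i).symm
    · exact if_neg h
  · have hI := ((hstep i).intervalIntegrable (P.b i)
      (P.deadline i)).absolutelyContinuousOnInterval_intervalIntegral (c := P.b i) (by simp)
    have hc : AbsolutelyContinuousOnInterval (fun _ => P.minExec i) (P.b i) (P.deadline i) :=
      (LipschitzWith.const (P.minExec i)).lipschitzOnWith.absolutelyContinuousOnInterval
    refine (hc.sub (hI.const_mul (θ i))).congr fun t ht => ?_
    rw [uIcc_of_le (hlt i).le] at ht
    simp [X, Y, ht.1, ht.2]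
  · have hI := ((hstep i).intervalIntegrable (P.b i) (P.deadline i)).ae_hasDerivAt_integral
    have hne : ∀ c : ℝ, ∀ᵐ t : ℝ, t ≠ c := fun c => by simp [ae_iff, measure_singleton]
    filter_upwards [hI, hne (P.b i), hne (P.deadline i)] with t ht hb hd
    by_cases h : t ∈ Icc (P.b i) (P.deadline i)
    · have hD := (((ht (by rwa [uIcc_of_le (hlt i).le]) (P.b i) (by simp)).const_mul
        (θ i)).const_sub (P.minExec i))
      have hev : X i =ᶠ[nhds t]
          fun t => P.minExec i - θ i * ∫ x in (P.b i)..t, workRate a s i x := by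
        filter_upwards [Ioo_mem_nhds (lt_of_le_of_ne h.1 hb.symm) (lt_of_le_of_ne h.2 hd)] with y hy
        simp [X, Y, hy.1.le, hy.2.le]
      have hDX := hD.congr_of_eventuallyEq hev
      refine ⟨hDX.differentiableAt, ?_⟩
      rw [hDX.deriv]
      exact neg_le_neg (mul_le_of_le_one_left (hnonneg i t) (hθ1 i))
    · have hev : X i =ᶠ[nhds t] fun _ => 0 := by
        filter_upwards [isClosed_Icc.isOpen_compl.mem_nhds h] with y hy
        exact if_neg hy
      have hDX := (hasDerivAt_const t (0 : ℝ)).congr_of_eventuallyEq hev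
      refine ⟨hDX.differentiableAt, ?_⟩
      rw [hDX.deriv]
      exact neg_nonpos.2 (hnonneg i t)

namespace IsPieceSchedule

variable {ω v : Fin n → (r : Fin 2) → Fin (l r) → Fin N → ℝ}
  {a : Fin n → (r : Fin 2) → Fin (P.m r) → ℝ → ℝ} {s : (r : Fin 2) → Fin (P.m r) → ℝ → ℝ}
  {Z : Fin n → (r : Fin 2) → Fin (P.m r) → Fin (l r) → Fin N → ℝ → Prop}

open Classical in
/-- At most one piece of a task runs on a processor, so a sum over the pieces that are running, with
weights `c q`, is the assignment times the weight `y` of the running piece. -/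
theorem sum_run_mul (h : IsPieceSchedule P τ ω v a s Z) (hτ : P.IsMajorGrid τ) {i r k μ t}
    (ht : t ∈ Ico (τ μ.castSucc) (τ μ.succ)) (c : Fin (l r) → ℝ) {y : ℝ}
    (hy : ∀ q, Z i r k q μ t → y = c q) :
    ∑ q, (if Z i r k q μ t then (1 : ℝ) else 0) * c q = a i r k t * y := by
  rw [h.assign_eq]
  by_cases hZ : ∃ q, Z i r k q μ t
  · obtain ⟨q, hq⟩ := hZ
    rw [Finset.sum_eq_single q, if_pos hq, if_pos ⟨μ, q, hq⟩, hy q hq]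
    · intro q' _ hne
      rw [if_neg fun hq' => hne (h.task_piece_unique hq' hq).2, zero_mul]
    · simp
  · have h1 : ¬ ∃ μ q, Z i r k q μ t := by
      rintro ⟨μ', q, hq⟩
      obtain rfl := hτ.interval_unique ht (h.mem_interval hq)
      exact hZ ⟨q, hq⟩
    push Not at hZ
    rw [if_neg h1, zero_mul]
    exact Finset.sum_eq_zero fun q _ => by rw [if_neg (hZ q), zero_mul]

theorem assign_zero_or_one (h : IsPieceSchedule P τ ω v a s Z) (i r k t) :
    a i r k t = 0 ∨ a i r k t = 1 := by
  classical
  rw [h.assign_eq]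
  split_ifs <;> simp

theorem exists_run (h : IsPieceSchedule P τ ω v a s Z) {i r k t} (ha : a i r k t = 1) :
    ∃ μ q, Z i r k q μ t := by
  classical
  by_contra hne
  rw [h.assign_eq, if_neg hne] at ha
  exact zero_ne_one ha

theorem stepwise_assign (h : IsPieceSchedule P τ ω v a s Z) (i r k) : Stepwise (a i r k) := by
  classical
  have := (Stepwise.pi fun z : Fin N × Fin (l r) => h.stepwise_run i r k z.2 z.1).comp
    fun p : Fin N × Fin (l r) → Prop => if ∃ μ q, p (μ, q) then (1 : ℝ) else 0
  refine (funext fun t => ?_ : a i r k = _) ▸ this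
  exact h.assign_eq i r k t

open Classical in
theorem integral_sum_run_mul (h : IsPieceSchedule P τ ω v a s Z) (i r μ) (c : Fin (l r) → ℝ) :
    ∫ t in (τ μ.castSucc)..(τ μ.succ),
      ∑ k, ∑ q, (if Z i r k q μ t then (1 : ℝ) else 0) * c q =
        gridStep τ μ * ∑ q, ω i r q μ * c q := by
  have hi : ∀ k q, IntervalIntegrable
      (fun t => (if Z i r k q μ t then (1 : ℝ) else 0) * c q) volume (τ μ.castSucc) (τ μ.succ) :=
    fun k q => ((h.stepwise_run i r k q μ).comp
      fun p => (if p then (1 : ℝ) else 0) * c q).intervalIntegrable _ _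
  rw [intervalIntegral.integral_finsetSum fun k _ => by
    have := IntervalIntegrable.sum Finset.univ fun q _ => hi k q
    simpa only [Finset.sum_fn] using this]
  simp_rw [intervalIntegral.integral_finsetSum fun q _ => hi _ q,
    intervalIntegral.integral_mul_const]
  rw [Finset.sum_comm, Finset.mul_sum]
  refine Finset.sum_congr rfl fun q _ => ?_
  rw [← Finset.sum_mul, h.integral_run, mul_assoc]

theorem stepwise_workRate (h : IsPieceSchedule P τ ω v a s Z) (i : Fin n) :
    Stepwise (workRate a s i) :=
  .finset_sum fun r => .finset_sum fun k => (h.stepwise_assign i r k).mul (h.stepwise_speed r k)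

theorem integral_workRate (h : IsPieceSchedule P τ ω v a s Z) (hτ : P.IsMajorGrid τ) (i μ) :
    ∫ t in (τ μ.castSucc)..(τ μ.succ), workRate a s i t =
      gridStep τ μ * ∑ r, ∑ q, ω i r q μ * v i r q μ := by
  classical
  have hle : τ μ.castSucc ≤ τ μ.succ := (sub_pos.1 (hτ.gridStep_pos μ)).le
  unfold workRate
  rw [intervalIntegral.integral_finsetSum fun r _ =>
    (Stepwise.finset_sum fun k =>
      (h.stepwise_assign i r k).mul (h.stepwise_speed r k)).intervalIntegrable _ _, Finset.mul_sum]
  refine Finset.sum_congr rfl fun r _ => ?_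
  rw [← h.integral_sum_run_mul]
  refine integral_congr_Ico hle fun t ht => Finset.sum_congr rfl fun k _ => ?_
  exact (h.sum_run_mul hτ ht _ fun q hq => h.speed_eq hq).symm

theorem integral_assign (h : IsPieceSchedule P τ ω v a s Z) (hτ : P.IsMajorGrid τ) (i r μ) :
    ∫ t in (τ μ.castSucc)..(τ μ.succ), ∑ k, a i r k t = gridStep τ μ * ∑ q, ω i r q μ := by
  classical
  have hle : τ μ.castSucc ≤ τ μ.succ := (sub_pos.1 (hτ.gridStep_pos μ)).le
  have := h.integral_sum_run_mul i r μ fun _ => 1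
  simp only [mul_one] at this
  rw [← this]
  refine integral_congr_Ico hle fun t ht => Finset.sum_congr rfl fun k _ => ?_
  have := h.sum_run_mul hτ (i := i) (k := k) ht (fun _ => 1) (y := 1) fun q _ => rfl
  simp only [mul_one] at this
  exact this.symm

open Classical in
/-- Time at the speed of piece `q`, if the other pieces of the task on that type have different
speeds. -/
theorem integral_speed_eq (h : IsPieceSchedule P τ ω v a s Z) (hτ : P.IsMajorGrid τ) {i r q μ}
    (hv : ∀ q', v i r q' μ = v i r q μ → q' = q) :
    ∫ t in (τ μ.castSucc)..(τ μ.succ), ∑ k, (if s r k t = v i r q μ then a i r k t else 0) =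
      gridStep τ μ * ω i r q μ := by
  have hle : τ μ.castSucc ≤ τ μ.succ := (sub_pos.1 (hτ.gridStep_pos μ)).le
  have h1 := h.integral_sum_run_mul i r μ fun q' => if q' = q then 1 else 0
  simp only [mul_ite, mul_one, mul_zero, Finset.sum_ite_eq', Finset.mem_univ, if_true] at h1
  rw [← h1]
  refine integral_congr_Ico hle fun t ht => Finset.sum_congr rfl fun k _ => ?_
  have h2 := h.sum_run_mul hτ (i := i) (k := k) ht (fun q' => if q' = q then 1 else 0)
    (y := if s r k t = v i r q μ then 1 else 0) fun q' hq' => by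
      rw [h.speed_eq hq']
      by_cases he : q' = q
      · subst he; simp
      · rw [if_neg he, if_neg fun h' => he (hv q' h')]
  simp only [mul_ite, mul_one, mul_zero, Finset.sum_ite_eq', Finset.mem_univ, if_true] at h2
  rw [← h2]

theorem speed_eq_of_assign (h : IsPieceSchedule P τ ω v a s Z) (hτ : P.IsMajorGrid τ) {i r k μ t}
    (ht : t ∈ Ico (τ μ.castSucc) (τ μ.succ)) (ha : a i r k t = 1) : ∃ q, s r k t = v i r q μ := by
  obtain ⟨μ', q, hq⟩ := h.exists_run ha
  obtain rfl := hτ.interval_unique ht (h.mem_interval hq)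
  exact ⟨q, h.speed_eq hq⟩

/-- The state of the discrete program ends at zero, so the work in the window of a task is at least
its minimum execution time. -/
theorem minExec_le_work (h : IsPieceSchedule P τ ω v a s Z) (hτ : P.IsMajorGrid τ)
    {x : Fin n → Fin (N + 1) → ℝ} (hinit : ∀ i μ, τ μ = P.b i → x i μ = P.minExec i)
    (hzero : ∀ i μ, τ μ ∉ P.window i → x i μ = 0)
    (hdyn : ∀ i (μ : Fin N), x i μ.castSucc -
      gridStep τ μ * ∑ r, ∑ q, ω i r q μ * v i r q μ ≤ x i μ.succ) (i : Fin n) :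
    P.minExec i ≤ ∫ t in (P.b i)..(P.deadline i), workRate a s i t := by
  have hint := (h.stepwise_workRate i).intervalIntegrable
  obtain ⟨μb, hμb⟩ := hτ.exists_eq_b i
  obtain ⟨μd, hμd⟩ := hτ.exists_eq_deadline i
  have hle : μb ≤ μd := by
    rw [← hτ.strictMono.le_iff_le, hμb, hμd]
    exact (b_lt_deadline i).le
  have hmono := monotone_add_work (x := x i)
    (W := fun μ => ∫ t in (0 : ℝ)..τ μ, workRate a s i t) fun μ => by
      rw [intervalIntegral.integral_interval_sub_left (hint _ _) (hint _ _),
        h.integral_workRate hτ]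
      exact hdyn i μ
  have h1 := hmono hle
  simp only at h1
  rw [hinit i μb hμb, hzero i μd (by rw [hμd]; simp [Instance.window]), hμb, hμd] at h1
  rw [← intervalIntegral.integral_interval_sub_left (hint 0 _) (hint 0 _)]
  linarith

theorem exists_isSchedule (h : IsPieceSchedule P τ ω v a s Z) (hτ : P.IsMajorGrid τ)
    {S : Fin 2 → Set ℝ} (hS : ∀ r, ∀ y ∈ S r, 0 ≤ y) (hs : ∀ r k t, s r k t ∈ S r)
    {x : Fin n → Fin (N + 1) → ℝ} (hinit : ∀ i μ, τ μ = P.b i → x i μ = P.minExec i)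
    (hzero : ∀ i μ, τ μ ∉ P.window i → x i μ = 0)
    (hdyn : ∀ i (μ : Fin N), x i μ.castSucc -
      gridStep τ μ * ∑ r, ∑ q, ω i r q μ * v i r q μ ≤ x i μ.succ) :
    ∃ X, IsSchedule P S X a s := by
  have hnonneg : ∀ i t, 0 ≤ workRate a s i t := fun i t =>
    Finset.sum_nonneg fun r _ => Finset.sum_nonneg fun k _ => by
      rcases h.assign_zero_or_one i r k t with ha | ha <;> rw [ha]
      · simp
      · simpa using hS r _ (hs r k t)
  obtain ⟨X, hX1, hX2, hX3, hX4⟩ := exists_state h.stepwise_workRate hnonneg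
    (h.minExec_le_work hτ hinit hzero hdyn)
  refine ⟨X, hX1, fun i t _ ht => hX2 i t ht, hX3,
    fun i => (hX4 i).mono fun t ht _ => ht, ?_, ?_, fun r k t _ => hs r k t,
    fun i r k t _ => h.assign_zero_or_one i r k t,
    fun i r k => (h.stepwise_assign i r k).isStepOn ordConnected_Icc,
    fun r k => (h.stepwise_speed r k).isStepOn ordConnected_Icc⟩
  · intro i t _
    rw [← Fintype.sum_sigma' (fun r k => a i r k t)]
    refine sum_zero_one_le_one (fun z => h.assign_zero_or_one i z.1 z.2 t) fun z z' hz hz' => ?_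
    obtain ⟨μ, q, hq⟩ := h.exists_run hz
    obtain ⟨μ', q', hq'⟩ := h.exists_run hz'
    obtain rfl := hτ.interval_unique (h.mem_interval hq) (h.mem_interval hq')
    exact h.proc_unique hq hq'
  · intro r k t _
    refine sum_zero_one_le_one (fun i => h.assign_zero_or_one i r k t) fun i j hi hj => ?_
    obtain ⟨μ, q, hq⟩ := h.exists_run hi
    obtain ⟨μ', q', hq'⟩ := h.exists_run hj
    obtain rfl := hτ.interval_unique (h.mem_interval hq) (h.mem_interval hq')
    exact (h.task_piece_unique hq hq').1

end IsPieceSchedule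

end Schedule

/-! ### Relations between the two programs -/

section Programs

variable {n N : ℕ} {P : Instance n} {τ : Fin (N + 1) → ℝ} {l : Fin 2 → ℕ}
  {lev : (r : Fin 2) → Fin (l r) → ℝ} {smin smax : Fin 2 → ℝ}

/-- A speed between the least and the greatest level is a convex combination of levels. -/
theorem exists_weights {l : ℕ} {lev : Fin l → ℝ} {a b y : ℝ} (ha : IsLeast (range lev) a)
    (hb : IsGreatest (range lev) b) (hy : y ∈ Icc a b) :
    ∃ c : Fin l → ℝ, (∀ q, 0 ≤ c q) ∧ ∑ q, c q = 1 ∧ ∑ q, c q * lev q = y := by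
  obtain ⟨p, rfl⟩ := ha.1
  obtain ⟨q, rfl⟩ := hb.1
  rw [← segment_eq_Icc (hy.1.trans hy.2)] at hy
  obtain ⟨u, v, hu, hv, huv, rfl⟩ := hy
  refine ⟨fun j => (if j = p then u else 0) + if j = q then v else 0, fun j => ?_, ?_, ?_⟩
  · positivity
  · simp [Finset.sum_add_distrib, huv]
  · simp [add_mul, Finset.sum_add_distrib]

theorem IsLPSolution.work_nonneg {x : Fin n → Fin (N + 1) → ℝ}
    {ω : Fin n → (r : Fin 2) → Fin (l r) → Fin N → ℝ} (h : IsLPSolution P lev τ x ω) (i r μ) :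
    0 ≤ totalWork ω i r μ :=
  Finset.sum_nonneg fun q _ => (h.frac_bounds i r q μ).1

/-- Running a task at its average speed on each type turns a solution of the linear program into one
of the nonlinear program. -/
theorem IsLPSolution.exists_isNLPSolution (hmin : ∀ r, IsLeast (range (lev r)) (smin r))
    (hmax : ∀ r, IsGreatest (range (lev r)) (smax r)) {x : Fin n → Fin (N + 1) → ℝ}
    {ω : Fin n → (r : Fin 2) → Fin (l r) → Fin N → ℝ} (h : IsLPSolution P lev τ x ω) :
    ∃ v, IsNLPSolution P smin smax τ x (totalWork ω) v := by
  have hle : ∀ r, smin r ≤ smax r := fun r => (hmin r).2 (hmax r).1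
  have hv : ∀ i r μ, ∃ v, (smin r ≤ v ∧ v ≤ smax r) ∧
      totalWork ω i r μ * v = ∑ q, ω i r q μ * lev r q := by
    intro i r μ
    have h0 : ∀ q, 0 ≤ ω i r q μ := fun q => (h.frac_bounds i r q μ).1
    rcases (h.work_nonneg i r μ).eq_or_lt with hW | hW
    · refine ⟨smin r, ⟨le_rfl, hle r⟩, ?_⟩
      rw [← hW, zero_mul]
      have hz := (Finset.sum_eq_zero_iff_of_nonneg fun q _ => h0 q).1 hW.symm
      exact (Finset.sum_eq_zero fun q hq => by rw [hz q hq, zero_mul]).symm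
    · refine ⟨(∑ q, ω i r q μ * lev r q) / totalWork ω i r μ, ⟨?_, ?_⟩,
        mul_div_cancel₀ _ hW.ne'⟩
      · rw [le_div_iff₀ hW, totalWork, Finset.mul_sum]
        refine Finset.sum_le_sum fun q _ => ?_
        rw [mul_comm]
        exact mul_le_mul_of_nonneg_left ((hmin r).2 ⟨q, rfl⟩) (h0 q)
      · rw [div_le_iff₀ hW, totalWork, Finset.mul_sum]
        refine Finset.sum_le_sum fun q _ => ?_
        rw [mul_comm (smax r)]
        exact mul_le_mul_of_nonneg_left ((hmax r).2 ⟨q, rfl⟩) (h0 q)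
  choose v hv1 hv2 using hv
  refine ⟨v, h.initial, h.zero_outside, fun i μ => ?_, h.task_le_one, h.capacity, hv1,
    fun i r μ => ⟨h.work_nonneg i r μ, ?_⟩⟩
  · simp only [hv2]
    exact h.dynamics i μ
  · exact (Finset.single_le_sum (f := fun r => totalWork ω i r μ)
      (fun r _ => h.work_nonneg i r μ) (Finset.mem_univ r)).trans (h.task_le_one i μ)

/-- Mixing the least and the greatest level turns a solution of the nonlinear program into one of
the linear program. -/
theorem IsNLPSolution.exists_isLPSolution (hmin : ∀ r, IsLeast (range (lev r)) (smin r))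
    (hmax : ∀ r, IsGreatest (range (lev r)) (smax r)) {x : Fin n → Fin (N + 1) → ℝ}
    {ω v : Fin n → Fin 2 → Fin N → ℝ} (h : IsNLPSolution P smin smax τ x ω v) :
    ∃ ω', IsLPSolution P lev τ x ω' := by
  have hc := fun i r μ => exists_weights (hmin r) (hmax r) (h.speed_bounds i r μ)
  choose c hc0 hc1 hc2 using hc
  have hsum : ∀ i r μ, ∑ q, ω i r μ * c i r μ q = ω i r μ := fun i r μ => by
    rw [← Finset.mul_sum, hc1, mul_one]
  refine ⟨fun i r q μ => ω i r μ * c i r μ q, h.initial, h.zero_outside, fun i μ => ?_,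
    fun i μ => ?_, fun r μ => ?_, fun i r q μ => ?_⟩
  · simp only [mul_assoc, ← Finset.mul_sum, hc2]
    exact h.dynamics i μ
  · simp only [hsum]
    exact h.task_le_one i μ
  · simp only [hsum]
    exact h.capacity r μ
  · have hw := h.frac_bounds i r μ
    have h0 := mul_nonneg hw.1 (hc0 i r μ q)
    refine ⟨h0, ?_⟩
    refine (Finset.single_le_sum (f := fun q => ω i r μ * c i r μ q)
      (fun q _ => mul_nonneg hw.1 (hc0 i r μ q)) (Finset.mem_univ q)).trans ?_
    rw [hsum]
    exact hw.2

end Programs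

/-! ### Necessity of the programs -/

section Necessity

variable {n N : ℕ} {P : Instance n} {τ : Fin (N + 1) → ℝ} {l : Fin 2 → ℕ}
  {lev : (r : Fin 2) → Fin (l r) → ℝ} {smin smax : Fin 2 → ℝ}

/-- Fractions of a time interval that satisfy the constraints of the linear program other than the
dynamics. -/
def admissibleFractions (n : ℕ) (m : Fin 2 → ℕ) (l : Fin 2 → ℕ) :
    Set (Fin n → (r : Fin 2) → Fin (l r) → ℝ) :=
  {y | (∀ i r q, 0 ≤ y i r q ∧ y i r q ≤ 1) ∧ (∀ i, ∑ r, ∑ q, y i r q ≤ 1) ∧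
    ∀ r, ∑ i, ∑ q, y i r q ≤ (m r : ℝ)}

/-- Rates of change of the states that are possible with admissible fractions. -/
def admissibleRates (n : ℕ) (m : Fin 2 → ℕ) (lev : (r : Fin 2) → Fin (l r) → ℝ) :
    Set (Fin n → ℝ) :=
  {z | ∃ y ∈ admissibleFractions n m l, ∀ i, -∑ r, ∑ q, y i r q * lev r q ≤ z i}

theorem isCompact_admissibleFractions (m : Fin 2 → ℕ) :
    IsCompact (admissibleFractions n m l) := by
  refine IsCompact.of_isClosed_subset (isCompact_Icc (a := fun _ _ _ => (0 : ℝ))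
    (b := fun _ _ _ => (1 : ℝ))) ?_ fun y hy => ⟨fun i r q => (hy.1 i r q).1,
      fun i r q => (hy.1 i r q).2⟩
  simp only [admissibleFractions, ofPred_and, ofPred_forall]
  refine (isClosed_iInter fun i => isClosed_iInter fun r => isClosed_iInter fun q =>
    (isClosed_le (by fun_prop) (by fun_prop)).inter
      (isClosed_le (by fun_prop) (by fun_prop))).inter
    ((isClosed_iInter fun i => isClosed_le (by fun_prop) (by fun_prop)).inter
      (isClosed_iInter fun r => isClosed_le (by fun_prop) (by fun_prop)))

theorem convex_admissibleFractions (m : Fin 2 → ℕ) :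
    Convex ℝ (admissibleFractions n m l) := by
  rintro y ⟨hy1, hy2, hy3⟩ y' ⟨hy1', hy2', hy3'⟩ a b ha hb hab
  have hconv : ∀ {c d e : ℝ}, c ≤ e → d ≤ e → a * c + b * d ≤ e := fun {c d e} hc hd => by
    calc a * c + b * d ≤ a * e + b * e :=
          add_le_add (mul_le_mul_of_nonneg_left hc ha) (mul_le_mul_of_nonneg_left hd hb)
      _ = e := by rw [← add_mul, hab, one_mul]
  refine ⟨fun i r q => ⟨?_, ?_⟩, fun i => ?_, fun r => ?_⟩ <;>
    simp only [Pi.add_apply, Pi.smul_apply, smul_eq_mul, Finset.sum_add_distrib, ← Finset.mul_sum]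
  · exact add_nonneg (mul_nonneg ha (hy1 i r q).1) (mul_nonneg hb (hy1' i r q).1)
  · exact hconv (hy1 i r q).2 (hy1' i r q).2
  · exact hconv (hy2 i) (hy2' i)
  · exact hconv (hy3 r) (hy3' r)

theorem convex_admissibleRates (m : Fin 2 → ℕ) : Convex ℝ (admissibleRates n m lev) := by
  rintro z ⟨y, hy, hz⟩ z' ⟨y', hy', hz'⟩ a b ha hb hab
  refine ⟨_, convex_admissibleFractions m hy hy' ha hb hab, fun i => ?_⟩
  have h1 := mul_le_mul_of_nonneg_left (hz i) ha
  have h2 := mul_le_mul_of_nonneg_left (hz' i) hb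
  simp only [Pi.add_apply, Pi.smul_apply, smul_eq_mul, add_mul, mul_assoc,
    Finset.sum_add_distrib, ← Finset.mul_sum]
  linarith

theorem isClosed_admissibleRates (m : Fin 2 → ℕ) : IsClosed (admissibleRates n m lev) := by
  let L : (Fin n → (r : Fin 2) → Fin (l r) → ℝ) → Fin n → ℝ :=
    fun y i => -∑ r, ∑ q, y i r q * lev r q
  have hL : Continuous L := by fun_prop
  have h := isClosed_Ici (a := (0 : Fin n → ℝ)).add_left_of_isCompact
    ((isCompact_admissibleFractions (n := n) (l := l) m).image hL)
  convert h using 1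
  ext z
  simp only [admissibleRates, mem_ofPred_eq, Set.mem_add, mem_image, mem_Ici]
  constructor
  · rintro ⟨y, hy, hz⟩
    exact ⟨L y, ⟨y, hy, rfl⟩, z - L y, sub_nonneg.2 hz, by simp⟩
  · rintro ⟨_, ⟨y, hy, rfl⟩, p, hp, rfl⟩
    exact ⟨y, hy, fun i => le_add_of_nonneg_right (hp i)⟩

/-- At each time, the processors' speeds split into levels give admissible fractions. -/
theorem IsSchedule.exists_admissibleFractions {S : Fin 2 → Set ℝ}
    (hmin : ∀ r, IsLeast (range (lev r)) (smin r))
    (hmax : ∀ r, IsGreatest (range (lev r)) (smax r)) (hS : ∀ r, S r ⊆ Icc (smin r) (smax r))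
    {x : Fin n → ℝ → ℝ} {a : Fin n → (r : Fin 2) → Fin (P.m r) → ℝ → ℝ}
    {s : (r : Fin 2) → Fin (P.m r) → ℝ → ℝ} (h : IsSchedule P S x a s) {t : ℝ}
    (ht : t ∈ Icc 0 P.horizon) :
    ∃ y ∈ admissibleFractions n P.m l, ∀ i,
      ∑ r, ∑ q, y i r q * lev r q = ∑ r, ∑ k, a i r k t * s r k t := by
  have hc := fun r k => exists_weights (hmin r) (hmax r) (hS r (h.speed_mem r k t ht))
  choose c hc0 hc1 hc2 using hc
  have ha : ∀ i r k, 0 ≤ a i r k t := fun i r k => by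
    rcases h.binary i r k t ht with h | h <;> simp [h]
  have hy0 : ∀ i r q, 0 ≤ ∑ k, a i r k t * c r k q :=
    fun i r q => Finset.sum_nonneg fun k _ => mul_nonneg (ha i r k) (hc0 r k q)
  have hsum : ∀ i r, ∑ q, ∑ k, a i r k t * c r k q = ∑ k, a i r k t := fun i r => by
    rw [Finset.sum_comm]
    exact Finset.sum_congr rfl fun k _ => by rw [← Finset.mul_sum, hc1, mul_one]
  have htask : ∀ i, ∑ r, ∑ q, ∑ k, a i r k t * c r k q ≤ 1 := fun i => by
    simp only [hsum]
    exact h.task_le_one i t ht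
  refine ⟨fun i r q => ∑ k, a i r k t * c r k q, ⟨fun i r q => ⟨hy0 i r q, ?_⟩, htask, fun r => ?_⟩,
    fun i => ?_⟩
  · calc ∑ k, a i r k t * c r k q ≤ ∑ q, ∑ k, a i r k t * c r k q :=
          Finset.single_le_sum (f := fun q => ∑ k, a i r k t * c r k q)
            (fun q _ => hy0 i r q) (Finset.mem_univ q)
      _ ≤ ∑ r, ∑ q, ∑ k, a i r k t * c r k q :=
          Finset.single_le_sum (f := fun r => ∑ q, ∑ k, a i r k t * c r k q)
            (fun r _ => Finset.sum_nonneg fun q _ => hy0 i r q) (Finset.mem_univ r)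
      _ ≤ 1 := htask i
  · simp only [hsum]
    rw [Finset.sum_comm]
    calc ∑ k, ∑ i, a i r k t ≤ ∑ _k : Fin (P.m r), (1 : ℝ) :=
          Finset.sum_le_sum fun k _ => h.proc_le_one r k t ht
      _ = P.m r := by simp
  · refine Finset.sum_congr rfl fun r _ => ?_
    simp only [Finset.sum_mul, mul_assoc]
    rw [Finset.sum_comm]
    exact Finset.sum_congr rfl fun k _ => by rw [← Finset.mul_sum, hc2]

/-- The average rate of change of the states in an interval of the grid is admissible, because the
rate is admissible at almost every time and the admissible rates form a closed convex set. This
needs no measurability of the assignment. States of tasks whose window does not contain the interval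
are disregarded. -/
theorem IsSchedule.exists_fractions_interval {S : Fin 2 → Set ℝ}
    (hlev : ∀ r q, 0 ≤ lev r q) (hτ : P.IsMajorGrid τ)
    (hmin : ∀ r, IsLeast (range (lev r)) (smin r))
    (hmax : ∀ r, IsGreatest (range (lev r)) (smax r)) (hS : ∀ r, S r ⊆ Icc (smin r) (smax r))
    {x : Fin n → ℝ → ℝ} {a : Fin n → (r : Fin 2) → Fin (P.m r) → ℝ → ℝ}
    {s : (r : Fin 2) → Fin (P.m r) → ℝ → ℝ} (h : IsSchedule P S x a s) (μ : Fin N) :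
    ∃ y ∈ admissibleFractions n P.m l, ∀ i, P.b i ≤ τ μ.castSucc → τ μ.succ ≤ P.deadline i →
      x i (τ μ.castSucc) - gridStep τ μ * ∑ r, ∑ q, y i r q * lev r q ≤ x i (τ μ.succ) := by
  classical
  have hh := hτ.gridStep_pos μ
  have hlt : τ μ.castSucc < τ μ.succ := sub_pos.1 hh
  let z : ℝ → Fin n → ℝ := fun t i =>
    if P.b i ≤ τ μ.castSucc ∧ τ μ.succ ≤ P.deadline i then deriv (x i) t else 0
  have hac : ∀ i, P.b i ≤ τ μ.castSucc ∧ τ μ.succ ≤ P.deadline i →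
      AbsolutelyContinuousOnInterval (x i) (τ μ.castSucc) (τ μ.succ) := by
    intro i hi
    refine (h.absCont i).mono ?_
    rw [uIcc_of_le hlt.le, uIcc_of_le (b_lt_deadline i).le]
    exact Icc_subset_Icc hi.1 hi.2
  have hzint : ∀ i, IntegrableOn (fun t => z t i) (Ioc (τ μ.castSucc) (τ μ.succ)) := by
    intro i
    by_cases hi : P.b i ≤ τ μ.castSucc ∧ τ μ.succ ≤ P.deadline i
    · simp only [z, hi, and_self, if_true]
      exact (intervalIntegrable_iff_integrableOn_Ioc_of_le hlt.le).1
        (hac i hi).intervalIntegrable_deriv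
    · simp only [z, hi, if_false]
      exact integrableOn_zero
  have hmem : ∀ᵐ t ∂volume.restrict (Ioc (τ μ.castSucc) (τ μ.succ)),
      z t ∈ admissibleRates n P.m lev := by
    rw [ae_restrict_iff' measurableSet_Ioc]
    filter_upwards [ae_all_iff.2 h.dynamics] with t ht htμ
    have htL : t ∈ Icc 0 P.horizon :=
      ⟨(hτ.nonneg _).trans htμ.1.le, htμ.2.trans (hτ.le_horizon _)⟩
    obtain ⟨y, hy, hyeq⟩ := h.exists_admissibleFractions hmin hmax hS htL
    refine ⟨y, hy, fun i => ?_⟩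
    by_cases hi : P.b i ≤ τ μ.castSucc ∧ τ μ.succ ≤ P.deadline i
    · simp only [z, hi, and_self, if_true, hyeq]
      exact (ht i htL).2
    · simp only [z, hi, if_false]
      exact neg_nonpos.2 (Finset.sum_nonneg fun r _ => Finset.sum_nonneg fun q _ =>
        mul_nonneg (hy.1 i r q).1 (hlev r q))
  have havg := (convex_admissibleRates (n := n) (lev := lev) P.m).set_average_mem
    (isClosed_admissibleRates P.m) (by simp [hlt]) (by simp) hmem (Integrable.of_eval hzint)
  obtain ⟨y, hy, hyz⟩ := havg
  refine ⟨y, hy, fun i hb hd => ?_⟩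
  have hi : P.b i ≤ τ μ.castSucc ∧ τ μ.succ ≤ P.deadline i := ⟨hb, hd⟩
  have hav : (⨍ t in Ioc (τ μ.castSucc) (τ μ.succ), z t) i =
      (gridStep τ μ)⁻¹ * (x i (τ μ.succ) - x i (τ μ.castSucc)) := by
    rw [setAverage_eq, Pi.smul_apply, smul_eq_mul, MeasureTheory.eval_integral hzint]
    congr 1
    · rw [Real.volume_real_Ioc_of_le hlt.le]
      rfl
    · rw [← intervalIntegral.integral_of_le hlt.le, ← (hac i hi).integral_deriv_eq_sub]
      simp only [z, hi, and_self, if_true]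
  have h1 := hyz i
  rw [hav, inv_mul_eq_div, le_div_iff₀ hh] at h1
  linarith

theorem IsSchedule.exists_isLPSolution {S : Fin 2 → Set ℝ}
    (hlev : ∀ r q, 0 ≤ lev r q) (hτ : P.IsMajorGrid τ)
    (hmin : ∀ r, IsLeast (range (lev r)) (smin r))
    (hmax : ∀ r, IsGreatest (range (lev r)) (smax r)) (hS : ∀ r, S r ⊆ Icc (smin r) (smax r))
    {x : Fin n → ℝ → ℝ} {a : Fin n → (r : Fin 2) → Fin (P.m r) → ℝ → ℝ}
    {s : (r : Fin 2) → Fin (P.m r) → ℝ → ℝ} (h : IsSchedule P S x a s) :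
    ∃ x' ω, IsLPSolution P lev τ x' ω := by
  choose y hy hdyn using h.exists_fractions_interval hlev hτ hmin hmax hS
  have hzero : ∀ i μ, τ μ ∉ P.window i → x i (τ μ) = 0 := fun i μ hμ =>
    h.zero_outside i _ ⟨hτ.nonneg μ, hτ.le_horizon μ⟩ hμ
  refine ⟨fun i μ => x i (τ μ), fun i r q μ => y μ i r q, fun i μ hμ => ?_, hzero, fun i μ => ?_,
    fun i μ => (hy μ).2.1 i, fun r μ => (hy μ).2.2 r, fun i r q μ => (hy μ).1 i r q⟩
  · simp only [hμ]
    exact h.initial i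
  · obtain ⟨μb, hμb⟩ := hτ.exists_eq_b i
    obtain ⟨μd, hμd⟩ := hτ.exists_eq_deadline i
    have hlt : τ μ.castSucc < τ μ.succ := sub_pos.1 (hτ.gridStep_pos μ)
    by_cases hw : τ μ.castSucc ∈ P.window i
    · refine hdyn μ i hw.1 ?_
      have := hw.2
      rw [← hμd] at this ⊢
      exact hτ.strictMono.monotone
        (Fin.castSucc_lt_iff_succ_le.1 (hτ.strictMono.lt_iff_lt.1 this))
    · -- the window can only open at the right end of the interval
      have hnn : 0 ≤ x i (τ μ.succ) := by
        by_cases hw' : τ μ.succ ∈ P.window i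
        · have hb : τ μ.castSucc < τ μb := by
            rw [hμb]
            by_contra hle
            exact hw ⟨not_lt.1 hle, hlt.trans hw'.2⟩
          have hb' : τ μ.succ ≤ P.b i := by
            rw [← hμb]
            exact hτ.strictMono.monotone
              (Fin.castSucc_lt_iff_succ_le.1 (hτ.strictMono.lt_iff_lt.1 hb))
          rw [le_antisymm hb' hw'.1, h.initial i]
          exact minExec_nonneg i
        · exact (hzero i _ hw').ge
      rw [hzero i _ hw, zero_sub]
      refine le_trans (neg_nonpos.2 (mul_nonneg (hτ.gridStep_pos μ).le ?_)) hnn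
      exact Finset.sum_nonneg fun r _ => Finset.sum_nonneg fun q _ =>
        mul_nonneg ((hy μ).1 i r q).1 (hlev r q)

end Necessity

/-! ### Vertices with at most one inter-cluster migrating task -/

/-- Some extreme point of a compact set maximizes a given continuous linear functional. -/
theorem exists_extremePoint_maximizer {E : Type*} [AddCommGroup E] [Module ℝ E]
    [TopologicalSpace E] [T2Space E] [IsTopologicalAddGroup E] [ContinuousSMul ℝ E]
    [LocallyConvexSpace ℝ E] {A : Set E} (hA : IsCompact A) (hne : A.Nonempty)
    (f : E →L[ℝ] ℝ) : ∃ z ∈ A.extremePoints ℝ, ∀ y ∈ A, f y ≤ f z := by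
  obtain ⟨z₀, hz₀, hmax⟩ := hA.exists_isMaxOn hne f.continuous.continuousOn
  have hexp : IsExposed ℝ A (f.toExposed A) := ContinuousLinearMap.toExposed.isExposed
  obtain ⟨z, hz⟩ := (hexp.isCompact hA).extremePoints_nonempty ⟨z₀, hz₀, fun y hy => hmax hy⟩
  exact ⟨z, hexp.isExtreme.extremePoints_subset_extremePoints hz, (extremePoints_subset hz).2⟩

section Vertex

variable {n N : ℕ} {P : Instance n} {τ : Fin (N + 1) → ℝ} {l : Fin 2 → ℕ}
  {lev : (r : Fin 2) → Fin (l r) → ℝ}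

theorem isClosed_lpRegion : IsClosed (lpRegion P lev τ) := by
  have : lpRegion P lev τ =
      {z | (∀ i μ, τ μ = P.b i → z.1 i μ = P.minExec i) ∧
        (∀ i μ, τ μ ∉ P.window i → z.1 i μ = 0) ∧
        (∀ i (μ : Fin N), z.1 i μ.castSucc - gridStep τ μ * ∑ r, ∑ q, z.2 i r q μ * lev r q ≤
          z.1 i μ.succ) ∧
        (∀ i μ, ∑ r, ∑ q, z.2 i r q μ ≤ 1) ∧
        (∀ r μ, ∑ i, ∑ q, z.2 i r q μ ≤ (P.m r : ℝ)) ∧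
        ∀ i r q μ, 0 ≤ z.2 i r q μ ∧ z.2 i r q μ ≤ 1} :=
    Set.ext fun z => ⟨fun h => ⟨h.1, h.2, h.3, h.4, h.5, h.6⟩,
      fun ⟨h1, h2, h3, h4, h5, h6⟩ => ⟨h1, h2, h3, h4, h5, h6⟩⟩
  rw [this]
  simp only [ofPred_and, ofPred_forall]
  refine .inter ?_ (.inter ?_ (.inter ?_ (.inter ?_ (.inter ?_ ?_))))
  · exact isClosed_iInter fun i => isClosed_iInter fun μ => isClosed_iInter fun _ =>
      isClosed_eq (by fun_prop) (by fun_prop)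
  · exact isClosed_iInter fun i => isClosed_iInter fun μ => isClosed_iInter fun _ =>
      isClosed_eq (by fun_prop) (by fun_prop)
  · exact isClosed_iInter fun i => isClosed_iInter fun μ =>
      isClosed_le (by fun_prop) (by fun_prop)
  · exact isClosed_iInter fun i => isClosed_iInter fun μ =>
      isClosed_le (by fun_prop) (by fun_prop)
  · exact isClosed_iInter fun i => isClosed_iInter fun μ =>
      isClosed_le (by fun_prop) (by fun_prop)
  · exact isClosed_iInter fun i => isClosed_iInter fun r => isClosed_iInter fun q =>
      isClosed_iInter fun μ => (isClosed_le (by fun_prop) (by fun_prop)).inter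
        (isClosed_le (by fun_prop) (by fun_prop))

/-- A state never falls faster than at unit speed and is known at both ends of the grid. -/
theorem IsLPSolution.abs_state_le (hlev : ∀ r q, lev r q ≤ 1)
    (hτ : P.IsMajorGrid τ) {x : Fin n → Fin (N + 1) → ℝ}
    {ω : Fin n → (r : Fin 2) → Fin (l r) → Fin N → ℝ} (h : IsLPSolution P lev τ x ω) (i μ) :
    |x i μ| ≤ τ (Fin.last N) := by
  have hmono := monotone_add_work (x := x i) (W := τ) fun μ => by
    refine le_trans ?_ (h.dynamics i μ)
    refine sub_le_sub_left (mul_le_of_le_one_right (hτ.gridStep_pos μ).le ?_) _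
    refine le_trans ?_ (h.task_le_one i μ)
    exact Finset.sum_le_sum fun r _ => Finset.sum_le_sum fun q _ =>
      mul_le_of_le_one_right (h.frac_bounds i r q μ).1 (hlev r q)
  have h0 : 0 ≤ x i 0 := by
    by_cases hw : τ 0 ∈ P.window i
    · have hb : τ 0 = P.b i := le_antisymm (hτ.zero_eq ▸ P.b_nonneg i) hw.1
      rw [h.initial i 0 hb]
      exact minExec_nonneg i
    · exact (h.zero_outside i 0 hw).ge
  have hlast : x i (Fin.last N) = 0 :=
    h.zero_outside i _ fun hw => absurd hw.2 (not_lt.2 (hτ.deadline_le_last i))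
  have h1 := hmono (Fin.zero_le μ)
  have h2 := hmono (Fin.le_last μ)
  simp only [hlast, hτ.zero_eq] at h1 h2
  have h3 := hτ.nonneg μ
  have h4 := hτ.strictMono.monotone (Fin.le_last μ)
  rw [abs_le]
  constructor <;> linarith

theorem isCompact_lpRegion (hlev : ∀ r q, lev r q ≤ 1) (hτ : P.IsMajorGrid τ) :
    IsCompact (lpRegion P lev τ) := by
  refine IsCompact.of_isClosed_subset (isCompact_Icc
    (a := ((fun _ _ => -τ (Fin.last N)), (fun _ _ _ _ => 0)))
    (b := ((fun _ _ => τ (Fin.last N)), (fun _ _ _ _ => 1)))) isClosed_lpRegion fun z hz => ?_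
  have hz' : IsLPSolution P lev τ z.1 z.2 := hz
  have hx := fun i μ => abs_le.1 (hz'.abs_state_le hlev hτ i μ)
  exact ⟨⟨fun i μ => (hx i μ).1, fun i r q μ => (hz'.frac_bounds i r q μ).1⟩,
    ⟨fun i μ => (hx i μ).2, fun i r q μ => (hz'.frac_bounds i r q μ).2⟩⟩

/-- Total speed-weighted fraction of a point of the space of the linear program. -/
noncomputable def totalSpeed (n N : ℕ) (lev : (r : Fin 2) → Fin (l r) → ℝ) :
    ((Fin n → Fin (N + 1) → ℝ) × (Fin n → (r : Fin 2) → Fin (l r) → Fin N → ℝ)) →L[ℝ] ℝ where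
  toFun z := ∑ i, ∑ μ, ∑ r, ∑ q, z.2 i r q μ * lev r q
  map_add' z z' := by simp [add_mul, Finset.sum_add_distrib]
  map_smul' c z := by
    simp only [Prod.smul_snd, Pi.smul_apply, smul_eq_mul, mul_assoc, Finset.mul_sum,
      RingHom.id_apply]
  cont := by fun_prop

/-- On each type `r`, move the fraction `δ r` in the `μ`-th interval from piece `qj r` of task `j`
to piece `qi r` of task `i`. -/
def shift (i j : Fin n) (μ : Fin N) (qi qj : (r : Fin 2) → Fin (l r)) (δ : Fin 2 → ℝ) :
    Fin n → (r : Fin 2) → Fin (l r) → Fin N → ℝ := fun i' r q μ' =>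
  if μ' = μ then
    (if i' = i then if q = qi r then δ r else 0 else 0) -
      (if i' = j then if q = qj r then δ r else 0 else 0)
  else 0

section shift

variable {i j : Fin n} {μ : Fin N} {qi qj : (r : Fin 2) → Fin (l r)} {δ : Fin 2 → ℝ}

theorem sum_shift_mul (c : (r : Fin 2) → Fin (l r) → ℝ) (i' r μ') :
    ∑ q, shift i j μ qi qj δ i' r q μ' * c r q =
      if μ' = μ then (if i' = i then δ r * c r (qi r) else 0) -
        (if i' = j then δ r * c r (qj r) else 0) else 0 := by
  unfold shift
  by_cases h1 : μ' = μ <;> by_cases h2 : i' = i <;> by_cases h3 : i' = j <;>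
    simp [h1, h2, h3, sub_mul, Finset.sum_sub_distrib]

theorem sum_shift (i' r μ') :
    ∑ q, shift i j μ qi qj δ i' r q μ' =
      if μ' = μ then (if i' = i then δ r else 0) - (if i' = j then δ r else 0) else 0 := by
  simpa using sum_shift_mul (i := i) (j := j) (μ := μ) (qi := qi) (qj := qj) (δ := δ)
    (fun _ _ => 1) i' r μ'

theorem shift_neg : shift i j μ qi qj (-δ) = -shift i j μ qi qj δ := by
  funext i' r q μ'
  simp only [shift, Pi.neg_apply]
  split_ifs <;> simp

theorem totalSpeed_shift (x : Fin n → Fin (N + 1) → ℝ) :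
    totalSpeed n N lev (x, shift i j μ qi qj δ) =
      ∑ r, δ r * lev r (qi r) - ∑ r, δ r * lev r (qj r) := by
  have h : ∀ i' : Fin n, ∑ μ', ∑ r, ∑ q, shift i j μ qi qj δ i' r q μ' * lev r q =
      (if i' = i then ∑ r, δ r * lev r (qi r) else 0) -
        (if i' = j then ∑ r, δ r * lev r (qj r) else 0) := by
    intro i'
    simp only [sum_shift_mul]
    rw [Finset.sum_eq_single μ (fun μ' _ h => by simp [h]) (by simp)]
    by_cases h2 : i' = i <;> by_cases h3 : i' = j <;> simp [h2, h3, Finset.sum_sub_distrib]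
  change ∑ i', ∑ μ', ∑ r, ∑ q, shift i j μ qi qj δ i' r q μ' * lev r q = _
  simp only [h, Finset.sum_sub_distrib, Finset.sum_ite_eq', Finset.mem_univ, if_true]

/-- A small shift that does not reduce the work on either task stays feasible. -/
theorem IsLPSolution.add_shift {x : Fin n → Fin (N + 1) → ℝ}
    {ω : Fin n → (r : Fin 2) → Fin (l r) → Fin N → ℝ} (hτ : P.IsMajorGrid τ)
    (h : IsLPSolution P lev τ x ω) (hij : i ≠ j)
    (hi : ∀ r, |δ r| ≤ ω i r (qi r) μ) (hj : ∀ r, |δ r| ≤ ω j r (qj r) μ)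
    (hi1 : ∑ r, ∑ q, ω i r q μ + ∑ r, |δ r| ≤ 1) (hj1 : ∑ r, ∑ q, ω j r q μ + ∑ r, |δ r| ≤ 1)
    (hwi : 0 ≤ ∑ r, δ r * lev r (qi r)) (hwj : ∑ r, δ r * lev r (qj r) ≤ 0) :
    IsLPSolution P lev τ x (ω + shift i j μ qi qj δ) := by
  have habs : ∑ r, δ r ≤ ∑ r, |δ r| := Finset.sum_le_sum fun r _ => le_abs_self _
  have habs' : -∑ r, δ r ≤ ∑ r, |δ r| := by
    rw [← Finset.sum_neg_distrib]
    exact Finset.sum_le_sum fun r _ => neg_le_abs _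
  have hji : j ≠ i := hij.symm
  have h0 : ∀ i' r q μ', 0 ≤ (ω + shift i j μ qi qj δ) i' r q μ' := by
    intro i' r q μ'
    have hnn := (h.frac_bounds i' r q μ').1
    have h1 := hi r
    have h2 := hj r
    have h3 := neg_abs_le (δ r)
    have h4 := le_abs_self (δ r)
    simp only [Pi.add_apply, shift]
    by_cases e1 : μ' = μ
    · subst e1
      by_cases e2 : i' = i
      · subst e2
        by_cases e3 : q = qi r
        · subst e3
          simp only [if_true, hij, if_false]
          linarith
        · simpa [e3, hij] using hnn
      · by_cases e3 : i' = j
        · subst e3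
          by_cases e4 : q = qj r
          · subst e4
            simp only [if_true, hji, if_false]
            linarith
          · simpa [e4, hji] using hnn
        · simpa [e2, e3] using hnn
    · simpa [e1] using hnn
  have htask : ∀ i' μ', ∑ r, ∑ q, (ω + shift i j μ qi qj δ) i' r q μ' ≤ 1 := by
    intro i' μ'
    have hle := h.task_le_one i' μ'
    simp only [Pi.add_apply, Finset.sum_add_distrib, sum_shift]
    by_cases e1 : μ' = μ
    · subst e1
      by_cases e2 : i' = i
      · subst e2
        simp only [if_true, hij, if_false, sub_zero]
        linarith
      · by_cases e3 : i' = j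
        · subst e3
          simp only [if_true, hji, if_false, zero_sub, Finset.sum_neg_distrib]
          linarith
        · simpa [e2, e3] using hle
    · simpa [e1] using hle
  refine ⟨h.initial, h.zero_outside, fun i' μ' => ?_, htask, fun r μ' => ?_, fun i' r q μ' =>
    ⟨h0 i' r q μ', ?_⟩⟩
  · refine le_trans (sub_le_sub_left (mul_le_mul_of_nonneg_left ?_ (hτ.gridStep_pos μ').le) _)
      (h.dynamics i' μ')
    simp only [Pi.add_apply, add_mul, Finset.sum_add_distrib, sum_shift_mul]
    refine le_add_of_nonneg_right ?_
    by_cases e1 : μ' = μ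
    · by_cases e2 : i' = i
      · subst e2
        simpa [e1, hij] using hwi
      · by_cases e3 : i' = j
        · subst e3
          simp only [e1, if_true, hji, if_false, zero_sub, Finset.sum_neg_distrib]
          exact neg_nonneg.2 hwj
        · simp [e2, e3]
    · simp [e1]
  · have hcap := h.capacity r μ'
    simp only [Pi.add_apply, Finset.sum_add_distrib, sum_shift]
    by_cases e1 : μ' = μ
    · simpa [e1, Finset.sum_sub_distrib] using hcap
    · simpa [e1] using hcap
  · calc (ω + shift i j μ qi qj δ) i' r q μ' ≤ ∑ q, (ω + shift i j μ qi qj δ) i' r q μ' :=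
          Finset.single_le_sum (f := fun q => (ω + shift i j μ qi qj δ) i' r q μ')
            (fun q _ => h0 i' r q μ') (Finset.mem_univ q)
      _ ≤ ∑ r, ∑ q, (ω + shift i j μ qi qj δ) i' r q μ' :=
          Finset.single_le_sum (f := fun r => ∑ q, (ω + shift i j μ qi qj δ) i' r q μ')
            (fun r _ => Finset.sum_nonneg fun q _ => h0 i' r q μ') (Finset.mem_univ r)
      _ ≤ 1 := htask i' μ'

end shift

/-- A nonzero direction orthogonal to `α` that does not increase the pairing with `β`. -/
theorem exists_direction (α β : Fin 2 → ℝ) :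
    ∃ δ : Fin 2 → ℝ, δ ≠ 0 ∧ ∑ r, δ r * α r = 0 ∧ ∑ r, δ r * β r ≤ 0 := by
  obtain ⟨δ, hδ, h⟩ : ∃ δ : Fin 2 → ℝ, δ ≠ 0 ∧ ∑ r, δ r * α r = 0 := by
    by_cases hα : α = 0
    · exact ⟨1, one_ne_zero, by simp [hα]⟩
    · refine ⟨![α 1, -α 0], fun h => hα ?_, by simp [Fin.sum_univ_two]; ring⟩
      have h0 := congrFun h 0
      have h1 := congrFun h 1
      simp at h0 h1
      ext r
      fin_cases r <;> simp [h0, h1]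
  rcases le_total (∑ r, δ r * β r) 0 with hle | hle
  · exact ⟨δ, hδ, h, hle⟩
  · refine ⟨-δ, neg_ne_zero.2 hδ, ?_, ?_⟩ <;>
      simp only [Pi.neg_apply, neg_mul, Finset.sum_neg_distrib]
    · rw [h, neg_zero]
    · exact neg_nonpos.2 hle

/-- A vertex that maximizes the total speed has at most one inter-cluster migrating task in each
interval. Given two such tasks, fractions can be shifted between them in a direction that keeps the
work on one and does not reduce the work on the other; by maximality the latter is kept, too, so the
opposite shift is feasible as well, and the point is not a vertex. -/
theorem atMostOneInterCluster_of_maximizer (hτ : P.IsMajorGrid τ)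
    {x : Fin n → Fin (N + 1) → ℝ} {ω : Fin n → (r : Fin 2) → Fin (l r) → Fin N → ℝ}
    (hext : (x, ω) ∈ (lpRegion P lev τ).extremePoints ℝ)
    (hmax : ∀ z ∈ lpRegion P lev τ, totalSpeed n N lev z ≤ totalSpeed n N lev (x, ω)) :
    AtMostOneInterCluster (totalWork ω) := by
  intro μ i hi j hj
  by_contra hij
  have h : IsLPSolution P lev τ x ω := hext.1
  have hrun : ∀ i, IsIMb (fun i r => totalWork ω i r μ) i → ∀ r, ∃ q, 0 < ω i r q μ := by
    intro i hi r
    have hpos : 0 < totalWork ω i r μ := by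
      fin_cases r
      exacts [hi.1, hi.2.1]
    by_contra hne
    push Not at hne
    exact absurd (Finset.sum_nonpos fun q _ => hne q) (not_le.2 hpos)
  have hslack : ∀ i, IsIMb (fun i r => totalWork ω i r μ) i → ∑ r, ∑ q, ω i r q μ < 1 := by
    intro i hi
    rw [Fin.sum_univ_two]
    exact hi.2.2
  choose qi hqi using hrun i hi
  choose qj hqj using hrun j hj
  have hsi := hslack i hi
  have hsj := hslack j hj
  obtain ⟨d, hd0, hdi, hdj⟩ := exists_direction (fun r => lev r (qi r)) (fun r => lev r (qj r))
  -- scale the direction so that all constraints that are not tight stay satisfied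
  have hev : ∀ᶠ ε : ℝ in nhds 0, (∀ r, |ε * d r| < ω i r (qi r) μ) ∧
      (∀ r, |ε * d r| < ω j r (qj r) μ) ∧ ∑ r, ∑ q, ω i r q μ + ∑ r, |ε * d r| < 1 ∧
      ∑ r, ∑ q, ω j r q μ + ∑ r, |ε * d r| < 1 := by
    have hlim : ∀ {f : ℝ → ℝ} {c : ℝ}, Continuous f → f 0 < c → ∀ᶠ ε in nhds 0, f ε < c :=
      fun hf h0 => hf.continuousAt.eventually (gt_mem_nhds h0)
    refine (Filter.eventually_all.2 fun r => hlim (by fun_prop) (by simpa using hqi r)).and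
      ((Filter.eventually_all.2 fun r => hlim (by fun_prop) (by simpa using hqj r)).and
        ((hlim (by fun_prop) (by simpa using hsi)).and
          (hlim (by fun_prop) (by simpa using hsj))))
  obtain ⟨ε, ⟨h1, h2, h3, h4⟩, hε⟩ :=
    ((hev.filter_mono nhdsWithin_le_nhds).and (self_mem_nhdsWithin (s := Ioi (0 : ℝ)))).exists
  have hε : 0 < ε := hε
  let δ : Fin 2 → ℝ := fun r => ε * d r
  have hδi : ∑ r, δ r * lev r (qi r) = 0 := by
    simp only [δ, mul_assoc, ← Finset.mul_sum]
    rw [hdi, mul_zero]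
  have hδj : ∑ r, δ r * lev r (qj r) ≤ 0 := by
    simp only [δ, mul_assoc, ← Finset.mul_sum]
    exact mul_nonpos_of_nonneg_of_nonpos hε.le hdj
  have hplus : IsLPSolution P lev τ x (ω + shift i j μ qi qj δ) :=
    h.add_shift hτ hij (fun r => (h1 r).le) (fun r => (h2 r).le) h3.le h4.le hδi.ge hδj
  have hδj0 : ∑ r, δ r * lev r (qj r) = 0 := by
    refine le_antisymm hδj ?_
    have hz : ((x, ω + shift i j μ qi qj δ) :
        (Fin n → Fin (N + 1) → ℝ) × (Fin n → (r : Fin 2) → Fin (l r) → Fin N → ℝ)) =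
        (x, ω) + (0, shift i j μ qi qj δ) := by simp
    have hm := hmax (x, ω + shift i j μ qi qj δ) hplus
    rw [hz, map_add, totalSpeed_shift] at hm
    linarith
  have hminus : IsLPSolution P lev τ x (ω + shift i j μ qi qj (-δ)) := by
    refine h.add_shift hτ hij (fun r => ?_) (fun r => ?_) ?_ ?_ ?_ ?_ <;>
      simp only [Pi.neg_apply, abs_neg, neg_mul, Finset.sum_neg_distrib]
    exacts [(h1 r).le, (h2 r).le, h3.le, h4.le, by rw [hδi, neg_zero], by rw [hδj0, neg_zero]]
  have hmid : ((x, ω) :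
      (Fin n → Fin (N + 1) → ℝ) × (Fin n → (r : Fin 2) → Fin (l r) → Fin N → ℝ)) ∈
      openSegment ℝ (x, ω + shift i j μ qi qj δ) (x, ω + shift i j μ qi qj (-δ)) := by
    refine ⟨1 / 2, 1 / 2, by norm_num, by norm_num, by norm_num, ?_⟩
    rw [shift_neg]
    refine Prod.ext ?_ ?_
    · simp only [Prod.smul_mk, Prod.mk_add_mk, ← add_smul]
      norm_num
    · simp only [Prod.smul_mk, Prod.mk_add_mk, ← smul_add]
      rw [show ω + shift i j μ qi qj δ + (ω + -shift i j μ qi qj δ) = (2 : ℝ) • ω by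
        rw [two_smul]; abel, smul_smul]
      norm_num
  have heq := hext.2 hplus hminus hmid
  have hshift : shift i j μ qi qj δ = 0 := by
    have := congrArg Prod.snd heq
    simpa using this
  apply hd0
  funext r
  have hr : shift i j μ qi qj δ i r (qi r) μ = 0 := by rw [hshift]; rfl
  simp only [shift, if_true, hij, if_false, sub_zero, δ] at hr
  exact (mul_eq_zero.1 hr).resolve_left hε.ne'

end Vertex

theorem exists_vertex_atMostOneInterCluster {n N : ℕ} {P : Instance n} {τ : Fin (N + 1) → ℝ}
    {l : Fin 2 → ℕ} {lev : (r : Fin 2) → Fin (l r) → ℝ} (hlev : ∀ r q, lev r q ≤ 1)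
    (hτ : P.IsMajorGrid τ) {x : Fin n → Fin (N + 1) → ℝ}
    {ω : Fin n → (r : Fin 2) → Fin (l r) → Fin N → ℝ} (h : IsLPSolution P lev τ x ω) :
    ∃ x ω, (x, ω) ∈ (lpRegion P lev τ).extremePoints ℝ ∧
      AtMostOneInterCluster (totalWork ω) := by
  obtain ⟨⟨x', ω'⟩, hext, hmax⟩ := exists_extremePoint_maximizer (isCompact_lpRegion hlev hτ)
    ⟨(x, ω), h⟩ (totalSpeed n N lev)
  exact ⟨x', ω', hext, atMostOneInterCluster_of_maximizer hτ hext hmax⟩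

end HeteroSched

/-! ### Equivalence of the scheduling problem and the programs -/

theorem theorem8 {n N : ℕ} (P : HeteroSched.Instance n)
    {l : Fin 2 → ℕ} (lev : (r : Fin 2) → Fin (l r) → ℝ) (smin smax : Fin 2 → ℝ)
    (hlev_inj : ∀ r, Function.Injective (lev r))
    (hlev_unit : ∀ r q, lev r q ∈ Set.Icc (0 : ℝ) 1)
    (hmin : ∀ r, IsLeast (Set.range (lev r)) (smin r))
    (hmax : ∀ r, IsGreatest (Set.range (lev r)) (smax r))
    (τ : Fin (N + 1) → ℝ) (hτ : P.IsMajorGrid τ) :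
    -- a solution of the scheduling problem yields solutions of the NLP and of the LP
    (∀ S : Fin 2 → Set ℝ,
      (∀ r, S r = Set.range (lev r) ∨ S r = Set.Icc (smin r) (smax r)) →
      (∃ x a s, IsSchedule P S x a s) →
        (∃ x ω v, IsNLPSolution P smin smax τ x ω v) ∧ (∃ x ω, IsLPSolution P lev τ x ω)) ∧
    -- a solvable LP has a vertex solution with at most one inter-cluster migrating task
    ((∃ x ω, IsLPSolution P lev τ x ω) →
      ∃ x ω, (x, ω) ∈ (lpRegion P lev τ).extremePoints ℝ ∧
        AtMostOneInterCluster (totalWork ω)) ∧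
    -- a solvable NLP has a solution with at most one inter-cluster migrating task
    ((∃ x ω v, IsNLPSolution P smin smax τ x ω v) →
      ∃ x ω v, IsNLPSolution P smin smax τ x ω v ∧ AtMostOneInterCluster ω) ∧
    -- from such an LP solution, Hetero-Wrap yields a valid schedule (discrete speed levels)
    (∀ x ω, IsLPSolution P lev τ x ω → AtMostOneInterCluster (totalWork ω) →
      ∃ X s, IsSchedule P (fun r => Set.range (lev r)) X
          (wrapAssignment P.m τ (totalWork ω)) s ∧
        (∀ r k, IsIntervalStepOn (s r k) (Set.Icc 0 P.horizon)) ∧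
        (∀ i r μ, ∫ t in (τ μ.castSucc)..(τ μ.succ),
            ∑ k, wrapAssignment P.m τ (totalWork ω) i r k t =
          gridStep τ μ * totalWork ω i r μ) ∧
        (∀ i r q μ, ∫ t in (τ μ.castSucc)..(τ μ.succ),
            ∑ k, (if s r k t = lev r q then wrapAssignment P.m τ (totalWork ω) i r k t else 0) =
          gridStep τ μ * ω i r q μ)) ∧
    -- from such an NLP solution, Hetero-Wrap yields a valid schedule (speed intervals)
    (∀ x ω v, IsNLPSolution P smin smax τ x ω v → AtMostOneInterCluster ω →
      ∃ X s, IsSchedule P (fun r => Set.Icc (smin r) (smax r)) X (wrapAssignment P.m τ ω) s ∧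
        (∀ r k, IsIntervalStepOn (s r k) (Set.Icc 0 P.horizon)) ∧
        (∀ i r μ, ∫ t in (τ μ.castSucc)..(τ μ.succ), ∑ k, wrapAssignment P.m τ ω i r k t =
          gridStep τ μ * ω i r μ) ∧
        (∀ i r k μ, ∀ t ∈ Set.Ico (τ μ.castSucc) (τ μ.succ),
          wrapAssignment P.m τ ω i r k t = 1 → s r k t = v i r μ)) := by
  have hlev0 : ∀ r q, 0 ≤ lev r q := fun r q => (hlev_unit r q).1
  have hlev1 : ∀ r q, lev r q ≤ 1 := fun r q => (hlev_unit r q).2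
  have hrange : ∀ r, Set.range (lev r) ⊆ Set.Icc (smin r) (smax r) := by
    rintro r _ ⟨q, rfl⟩
    exact ⟨(hmin r).2 ⟨q, rfl⟩, (hmax r).2 ⟨q, rfl⟩⟩
  have hsmin0 : ∀ r, 0 ≤ smin r := by
    intro r
    obtain ⟨q, hq⟩ := (hmin r).1
    exact hq ▸ hlev0 r q
  refine ⟨fun S hS ⟨x, a, s, h⟩ => ?_, fun ⟨x, ω, h⟩ =>
    exists_vertex_atMostOneInterCluster hlev1 hτ h, fun ⟨x, ω, v, h⟩ => ?_,
    fun x ω h hone => ?_, fun x ω v h hone => ?_⟩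
  · have hS' : ∀ r, S r ⊆ Set.Icc (smin r) (smax r) := fun r => by
      rcases hS r with h | h <;> rw [h]
      exact hrange r
    obtain ⟨x', ω, hLP⟩ := h.exists_isLPSolution hlev0 hτ hmin hmax hS'
    obtain ⟨v, hv⟩ := hLP.exists_isNLPSolution hmin hmax
    exact ⟨⟨x', _, v, hv⟩, ⟨x', ω, hLP⟩⟩
  · obtain ⟨ω', h'⟩ := h.exists_isLPSolution hmin hmax
    obtain ⟨x'', ω'', hext, hone⟩ := exists_vertex_atMostOneInterCluster hlev1 hτ h'
    obtain ⟨v'', hv⟩ :=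
      IsLPSolution.exists_isNLPSolution hmin hmax (hext.1 : IsLPSolution _ _ _ _ _)
    exact ⟨x'', _, v'', hv, hone⟩
  · obtain ⟨s, Z, hZ, hs⟩ := exists_isPieceSchedule_wrapAssignment (v := fun _ r q _ => lev r q)
      (S := fun r => Set.range (lev r)) hτ (fun r => ⟨_, (hmin r).1⟩) (fun i r q μ => ⟨q, rfl⟩)
      (fun i r q μ => (h.frac_bounds i r q μ).1) h.task_le_one h.capacity hone
    obtain ⟨X, hX⟩ := hZ.exists_isSchedule hτ (fun r y hy => (hsmin0 r).trans (hrange r hy).1) hs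
      h.initial h.zero_outside h.dynamics
    refine ⟨X, s, hX, fun r k => (hZ.stepwise_speed r k).isIntervalStepOn Set.ordConnected_Icc,
      fun i r μ => hZ.integral_assign hτ i r μ, fun i r q μ => ?_⟩
    have := hZ.integral_speed_eq hτ (i := i) (r := r) (q := q) (μ := μ)
      fun q' hq' => hlev_inj r hq'
    convert this
  · -- a task of the nonlinear program is a single piece on each type
    have hwork : totalWork (l := fun _ => 1) (fun i r _ μ => ω i r μ) = ω := by
      funext i r μ
      simp [totalWork]
    obtain ⟨s, Z, hZ, hs⟩ := exists_isPieceSchedule_wrapAssignment (l := fun _ => 1)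
      (ω := fun i r _ μ => ω i r μ) (v := fun i r _ μ => v i r μ)
      (S := fun r => Set.Icc (smin r) (smax r)) hτ (fun r => ⟨_, hrange r (hmin r).1⟩)
      (fun i r q μ => h.speed_bounds i r μ) (fun i r q μ => (h.frac_bounds i r μ).1)
      (by simpa using h.task_le_one) (by simpa using h.capacity) (by rwa [hwork])
    rw [hwork] at hZ
    obtain ⟨X, hX⟩ := hZ.exists_isSchedule hτ (fun r y hy => (hsmin0 r).trans hy.1) hs
      h.initial h.zero_outside (by simpa using h.dynamics)
    refine ⟨X, s, hX, fun r k => (hZ.stepwise_speed r k).isIntervalStepOn Set.ordConnected_Icc,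
      fun i r μ => by simpa using hZ.integral_assign hτ i r μ, fun i r k μ t ht ha => ?_⟩
    obtain ⟨q, hq⟩ := hZ.speed_eq_of_assign hτ ht ha
    exact hq
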